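/- Fix an integer $n\ge 3$. A \emph{generalized $n$-gon} is a bipartite graph of diameter $n$ and girth $2n$ in which every vertex has valency at least $3$; it is regarded as a first-order structure in the language of graphs expanded by predicates for the two classes of the bipartition. It is \emph{open} if every nonempty finite subgraph of it contains a vertex of valency at most $1$ in that subgraph (a loose end) or a clean arc, i.e. the interior $(x_1,\dots,x_{n-2})$ of a path $(x_0,\dots,x_{n-1})$ in the subgraph such that each of $x_1,\dots,x_{n-2}$ has valency $2$ in the subgraph. For a finite set $A$ of vertices let $\delta_n(A)=(n-1)|A|-(n-2)|E(A)|$, where $E(A)$ is the set of edges between elements of $A$. (a) If $\Gamma$ is an open generalized $n$-gon such that every finite set $A_0\subseteq\Gamma$ is contained in a finite set $A\subseteq\Gamma$ with $\delta_n(A)=2n+2$, then $\Gamma$ has no proper elementary submodels (no proper elementary substructures). (b) In particular, let $\Gamma^{n+3}=\bigcup_{i<\omega}\Gamma_i$ be the free $n$-completion of the path $\Gamma_0=(x_0,\dots,x_{n+3})$, where $\Gamma_{i+1}$ is obtained from $\Gamma_i$ by adding, for every two vertices $a,b$ at distance $n+1$ in $\Gamma_i$, a new path of length $n-1$ from $a$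 to $b$ with $n-2$ new interior vertices. Then $\Gamma^{n+3}$ is minimal, i.e. it has no proper elementary submodels. -/

import Mathlib

namespace GenPolygon

universe u

/-! ### The language of graphs with predicates for the bipartition -/

/-- Relation symbols: a binary incidence symbol and one unary predicate for each of the two
classes of the bipartition. -/
inductive BipRel : ℕ → Type
  | adj : BipRel 2
  | side (s : Bool) : BipRel 1

/-- The language of graphs expanded by predicates for the bipartition. -/
def bipLang : FirstOrder.Language := ⟨fun _ => Empty, BipRel⟩

/-- The first-order structure given by a bipartite graph `G` with bipartition `C`. -/
@[reducible]
def bipStructure {V : Type u} {G : SimpleGraph V} (C : G.Coloring Bool) : bipLang.Structure V where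
  funMap := fun f _ => nomatch f
  RelMap := fun r x =>
    match r, x with
    | .adj, x => G.Adj (x 0) (x 1)
    | .side s, x => C (x 0) = s

/-- A bipartite graph is minimal (as a first-order structure) if it has no proper elementary
substructure. -/
def IsMinimal {V : Type u} {G : SimpleGraph V} (C : G.Coloring Bool) : Prop :=
  letI := bipStructure C
  ∀ S : bipLang.ElementarySubstructure V, S = ⊤

/-! ### Generalized polygons -/

/-- A (thick) generalized `n`-gon: a bipartite graph of diameter `n` and girth `2n` in which every
vertex has valency at least `3`. -/
structure IsGeneralizedPolygon (n : ℕ) {V : Type u} (G : SimpleGraph V) : Prop where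
  bipartite : G.IsBipartite
  diameter : G.ediam = (n : ℕ∞)
  girth : G.egirth = ((2 * n : ℕ) : ℕ∞)
  thick : ∀ v : V, 3 ≤ (G.neighborSet v).encard

/-- `G` contains a loose end, i.e. a vertex of valency at most `1`. -/
def HasLooseEnd {V : Type u} (G : SimpleGraph V) : Prop :=
  ∃ v : V, (G.neighborSet v).encard ≤ 1

/-- `G` contains a clean arc: the interior `(x₁, …, xₙ₋₂)` of a path `(x₀, …, xₙ₋₁)` such that
each of `x₁, …, xₙ₋₂` has valency `2` in `G`. -/
def HasCleanArc (n : ℕ) {V : Type u} (G : SimpleGraph V) : Prop :=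
  ∃ (x y : V) (p : G.Walk x y), p.IsPath ∧ p.length = n - 1 ∧
    ∀ i : ℕ, 1 ≤ i → i ≤ n - 2 → (G.neighborSet (p.getVert i)).encard = 2

/-- `G` is open if every nonempty finite subgraph contains a loose end or a clean arc. -/
def IsOpenGraph (n : ℕ) {V : Type u} (G : SimpleGraph V) : Prop :=
  ∀ A : Finset V, A.Nonempty →
    HasLooseEnd (G.induce (A : Set V)) ∨ HasCleanArc n (G.induce (A : Set V))

/-- `δₙ(A) = (n - 1) |A| - (n - 2) |E(A)|` for a finite set `A` of vertices, where `E(A)` is the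
set of edges of the subgraph induced on `A`. -/
noncomputable def delta (n : ℕ) {V : Type u} (G : SimpleGraph V) (A : Finset V) : ℤ :=
  ((n : ℤ) - 1) * (A.card : ℤ) - ((n : ℤ) - 2) * ((G.induce (A : Set V)).edgeSet.ncard : ℤ)

/-! ### Free completions -/

/-- Names for the vertices of free completions: the original vertices, and, for all `a`, `b`, names
`arc a b i` for the vertices of a new arc from `a` to `b`. -/
inductive FreeVertex (V : Type u) : Type u
  | base (v : V) : FreeVertex V
  | arc (a b : FreeVertex V) (i : ℕ) : FreeVertex V

/-- The pairs `a, b` at distance `n + 1` in `G`, each unordered pair being taken in just one of the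
two orders. -/
def NeedsArc (n : ℕ) {W : Type u} (G : SimpleGraph W) (a b : W) : Prop :=
  WellOrderingRel a b ∧ G.dist a b = n + 1

/-- The path `(x₀, …, xₙ₋₁)` with `x₀ = a`, `xₙ₋₁ = b` and with the new vertices
`xᵢ = arc a b i`, `1 ≤ i ≤ n - 2`, in between. -/
def arcPath (n : ℕ) {V : Type u} (a b : FreeVertex V) (i : ℕ) : FreeVertex V :=
  if i = 0 then a else if i + 1 < n then .arc a b i else b

/-- Add the edges of the new arcs between all pairs of vertices at distance `n + 1`. -/
def addArcs (n : ℕ) {V : Type u} (G : SimpleGraph (FreeVertex V)) : SimpleGraph (FreeVertex V) :=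
  G ⊔ SimpleGraph.fromRel fun x y => ∃ a b, NeedsArc n G a b ∧
    ∃ i, i + 1 < n ∧ x = arcPath n a b i ∧ y = arcPath n a b (i + 1)

/-- The edges of the `k`-th stage `Γₖ` of the free completion of `G₀`. The vertices of `Γₖ` are
those in `stageVerts`; all other names are isolated and so do not affect distances. -/
def stageGraph (n : ℕ) {V : Type u} (G₀ : SimpleGraph V) : ℕ → SimpleGraph (FreeVertex V)
  | 0 => G₀.map FreeVertex.base
  | k + 1 => addArcs n (stageGraph n G₀ k)

/-- The vertices of the `k`-th stage `Γₖ` of the free completion of `G₀`. -/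
def stageVerts (n : ℕ) {V : Type u} (G₀ : SimpleGraph V) : ℕ → Set (FreeVertex V)
  | 0 => Set.range FreeVertex.base
  | k + 1 => stageVerts n G₀ k ∪
      {x | ∃ a b, NeedsArc n (stageGraph n G₀ k) a b ∧ ∃ i, 1 ≤ i ∧ i + 1 < n ∧ x = .arc a b i}

/-- The free `n`-completion `F(G₀) = ⋃ₖ Γₖ`. -/
def freeCompletion (n : ℕ) {V : Type u} (G₀ : SimpleGraph V) :
    SimpleGraph {x : FreeVertex V // ∃ k, x ∈ stageVerts n G₀ k} :=
  (⨆ k, stageGraph n G₀ k).comap Subtype.val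

/-- The extension of a bipartition of the original vertices to all names: the classes alternate
along each new arc. -/
def freeSide {V : Type u} (c : V → Bool) : FreeVertex V → Bool
  | .base v => c v
  | .arc a _ i => xor (freeSide c a) i.bodd

theorem freeSide_eq_of_walk {V : Type u} {H : SimpleGraph V} (f : V → Bool)
    (hf : ∀ x y, H.Adj x y → f x ≠ f y) {a b : V} (p : H.Walk a b) :
    f b = xor (f a) p.length.bodd := by
  induction p with
  | nil => simp
  | @cons u v w h p ih =>
    have := hf _ _ h
    rw [SimpleGraph.Walk.length_cons, Nat.bodd_succ, ih]
    revert this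
    cases f u <;> cases f v <;> cases p.length.bodd <;> simp

theorem freeSide_arcPath (n : ℕ) {V : Type u} (c : V → Bool) {H : SimpleGraph (FreeVertex V)}
    (hf : ∀ x y, H.Adj x y → freeSide c x ≠ freeSide c y) {a b : FreeVertex V}
    (hd : H.dist a b = n + 1) (i : ℕ) (hi : i < n) :
    freeSide c (arcPath n a b i) = xor (freeSide c a) i.bodd := by
  unfold arcPath
  split_ifs with h0 h1
  · subst h0; simp
  · rfl
  · obtain ⟨p, hp⟩ := (SimpleGraph.Reachable.of_dist_ne_zero (by omega :
      H.dist a b ≠ 0)).exists_walk_length_eq_dist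
    have hn : n = i + 1 := by omega
    rw [freeSide_eq_of_walk _ hf p, hp, hd, hn]
    simp [Nat.bodd_succ]

/-- The two classes alternate along every edge of every stage of the free completion. -/
theorem freeSide_ne_of_stage (n : ℕ) {V : Type u} {G₀ : SimpleGraph V} (C : G₀.Coloring Bool)
    (k : ℕ) : ∀ x y, (stageGraph n G₀ k).Adj x y → freeSide C x ≠ freeSide C y := by
  induction k with
  | zero =>
    rintro x y h
    rw [stageGraph, SimpleGraph.map_adj'] at h
    obtain ⟨-, u, v, huv, rfl, rfl⟩ := h
    exact C.valid huv
  | succ k ih =>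
    have key : ∀ x y, (∃ a b, NeedsArc n (stageGraph n G₀ k) a b ∧
        ∃ i, i + 1 < n ∧ x = arcPath n a b i ∧ y = arcPath n a b (i + 1)) →
        freeSide C x ≠ freeSide C y := by
      rintro x y ⟨a, b, ⟨-, hd⟩, i, hi, rfl, rfl⟩
      rw [freeSide_arcPath n C ih hd i (by omega), freeSide_arcPath n C ih hd (i + 1) hi,
        Nat.bodd_succ]
      cases freeSide C a <;> cases i.bodd <;> simp
    intro x y h
    rw [stageGraph, addArcs, SimpleGraph.sup_adj, SimpleGraph.fromRel_adj] at h
    rcases h with h | ⟨-, h | h⟩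
    · exact ih x y h
    · exact key x y h
    · exact (key y x h).symm

/-- The bipartition of the free completion that extends a given bipartition of `G₀`. -/
def freeColoring (n : ℕ) {V : Type u} {G₀ : SimpleGraph V} (C : G₀.Coloring Bool) :
    (freeCompletion n G₀).Coloring Bool :=
  SimpleGraph.Coloring.mk (fun x => freeSide C x.1) (by
    intro x y h
    simp only [freeCompletion, SimpleGraph.comap_adj, SimpleGraph.iSup_adj] at h
    obtain ⟨k, hk⟩ := h
    exact freeSide_ne_of_stage n C k _ _ hk)

/-- `Γᵏ`: the free `n`-completion of the path `(x₀, …, xₖ)`. -/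
abbrev freePolygon (n k : ℕ) :
    SimpleGraph {x : FreeVertex (Fin (k + 1)) //
      ∃ j, x ∈ stageVerts n (SimpleGraph.pathGraph (k + 1)) j} :=
  freeCompletion n (SimpleGraph.pathGraph (k + 1))

end GenPolygon

/-! Let T be the underlying set of an elementary substructure. Elementarity puts a copy of every
finite set inside T, over any finite part of T (`hasCopies_of_elementarySubstructure`); no other
logic is used. Suppose that T is not everything.

Removing a loose end lowers δₙ, and removing a clean arc, with its n-2 vertices and n-1 edges,
preserves it. Openness also holds relative to T: three copies of B glued over B ∩ T give each point
of T next to B \ T valency at least 3, so a loose end, or the interior of a clean arc, is found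
outside T (`HasCopies.looseEnd_or_arc`). Hence B can be stripped down to B ∩ T without ever raising
δₙ. The last removal is a loose end, because the girth keeps an arc with both ends in T inside T
(`HasCopies.arc_mem`). So δₙ(B ∩ T) < δₙ(B) whenever B is not contained in T
(`HasCopies.delta_filter_lt`).

If δₙ(B) = 2n+2, then δₙ(B ∩ T) ≤ 2n+1. Such sets are classified by induction along the same
removals (`smallShape_of_delta_le`): they have at most one more edge than vertices, hence fewer than
3n vertices (`card_lt_of_delta_le`). But B may be chosen to contain a point outside T and a copy
inside T of a set with at least 3n elements, a contradiction (`HasCopies.eq_univ`).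

The argument needs openness, girth at least 2n, cofinality of the sets with δₙ = 2n+2, and some set
of at least 3n vertices. In (a) the last holds because an open graph with all valencies at least 3
is infinite. For (b), `ArcTower` axiomatizes the stages: openness is read off from the last stage
that a finite set meets, the girth comes from a lower bound on walk lengths (`ArcTower.Reach`), and
δₙ keeps its initial value on all stages because only arcs are added. Diameter and thickness of the
free completion are not needed. -/

namespace GenPolygon

universe u v
variable {V : Type u}

/-! ### Edge counts -/

/-- The neighbours of `v` in the finite set `A`. -/
noncomputable def nbrs (G : SimpleGraph V) (A : Finset V) (v : V) : Finset V := by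
  classical exact A.filter (G.Adj v)

/-- The number of edges between elements of the finite set `A`. -/
noncomputable def numEdges (G : SimpleGraph V) (A : Finset V) : ℕ :=
  (G.induce (A : Set V)).edgeSet.ncard

theorem mem_nbrs {G : SimpleGraph V} {A : Finset V} {v w : V} :
    w ∈ nbrs G A v ↔ w ∈ A ∧ G.Adj v w := by
  classical simp [nbrs]

theorem nbrs_mono {G : SimpleGraph V} {A B : Finset V} (h : A ⊆ B) (v : V) :
    nbrs G A v ⊆ nbrs G B v := fun w hw => by
  rw [mem_nbrs] at hw ⊢
  exact ⟨h hw.1, hw.2⟩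

theorem delta_eq (n : ℕ) (G : SimpleGraph V) (A : Finset V) :
    delta n G A = ((n : ℤ) - 1) * A.card - ((n : ℤ) - 2) * numEdges G A := rfl

theorem encard_neighborSet_induce (G : SimpleGraph V) (A : Finset V) (v : (A : Set V)) :
    ((G.induce (A : Set V)).neighborSet v).encard = (nbrs G A v).card := by
  rw [← Set.encard_coe_eq_coe_finsetCard, ← Subtype.val_injective.encard_image]
  congr 1
  ext w
  simp only [Set.mem_image, SimpleGraph.mem_neighborSet, SimpleGraph.comap_adj,
    Function.Embedding.subtype_apply, Finset.mem_coe, mem_nbrs]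
  constructor
  · rintro ⟨y, hy, rfl⟩
    exact ⟨y.2, hy⟩
  · rintro ⟨hw, h⟩
    exact ⟨⟨w, hw⟩, h, rfl⟩

theorem two_mul_numEdges (G : SimpleGraph V) (A : Finset V) :
    2 * numEdges G A = ∑ v ∈ A, (nbrs G A v).card := by
  classical
  have h := (G.induce (A : Set V)).sum_degrees_eq_twice_card_edges
  rw [numEdges, Set.ncard_eq_toFinset_card']
  rw [SimpleGraph.edgeFinset] at h
  rw [← h, ← Finset.sum_coe_sort A fun v => (nbrs G A v).card]
  refine Finset.sum_congr rfl fun v _ => ?_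
  have := encard_neighborSet_induce G A v
  rw [← SimpleGraph.card_neighborSet_eq_degree]
  rw [Set.encard_eq_coe_toFinset_card, Set.toFinset_card] at this
  exact_mod_cast this

theorem numEdges_erase [DecidableEq V] (G : SimpleGraph V) {A : Finset V} {v : V} (hv : v ∈ A) :
    numEdges G A = numEdges G (A.erase v) + (nbrs G A v).card := by
  have h1 := two_mul_numEdges G A
  have h2 := two_mul_numEdges G (A.erase v)
  rw [← Finset.add_sum_erase A _ hv] at h1
  have key : ∀ w ∈ A.erase v, (nbrs G A w).card =
      (nbrs G (A.erase v) w).card + if w ∈ nbrs G A v then 1 else 0 := by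
    intro w hw
    have hw' := Finset.mem_erase.1 hw
    have hE : nbrs G (A.erase v) w = (nbrs G A w).erase v := by
      ext z
      simp only [mem_nbrs, Finset.mem_erase]
      tauto
    rw [hE]
    split_ifs with h
    · have : v ∈ nbrs G A w := mem_nbrs.2 ⟨hv, (mem_nbrs.1 h).2.symm⟩
      rw [Finset.card_erase_add_one this]
    · have : v ∉ nbrs G A w := fun h' => h (mem_nbrs.2 ⟨hw'.2, (mem_nbrs.1 h').2.symm⟩)
      rw [Finset.erase_eq_of_notMem this, add_zero]
  rw [Finset.sum_congr rfl key, Finset.sum_add_distrib, ← h2, Finset.sum_ite_mem,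
    Finset.inter_eq_right.2] at h1
  · simp only [Finset.sum_const, smul_eq_mul, mul_one] at h1
    omega
  · intro w hw
    rw [mem_nbrs] at hw
    exact Finset.mem_erase.2 ⟨hw.2.ne', hw.1⟩

theorem numEdges_empty (G : SimpleGraph V) : numEdges G ∅ = 0 := by
  have := two_mul_numEdges G ∅
  simpa using this

/-! ### Clean arcs as sequences -/

/-- The interior of the sequence `(x₀, …, xₙ₋₁)` is a clean arc in `A`. -/
structure IsCleanArc (n : ℕ) (G : SimpleGraph V) (A : Finset V) (x : ℕ → V) : Prop where
  inj : ∀ i j, i < n → j < n → x i = x j → i = j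
  mem : ∀ i < n, x i ∈ A
  adj : ∀ i, i + 1 < n → G.Adj (x i) (x (i + 1))
  valency : ∀ i, 1 ≤ i → i + 1 < n → (nbrs G A (x i)).card = 2

/-- The set `{x₁, …, xₙ₋₂}`. -/
noncomputable def arcInterior (n : ℕ) (x : ℕ → V) : Finset V := by
  classical exact (Finset.Ico 1 (n - 1)).image x

theorem mem_arcInterior {n : ℕ} {x : ℕ → V} {v : V} :
    v ∈ arcInterior n x ↔ ∃ i, 1 ≤ i ∧ i + 1 < n ∧ x i = v := by
  classical
  simp only [arcInterior, Finset.mem_image, Finset.mem_Ico]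
  exact exists_congr fun i => by constructor <;> rintro ⟨h, h'⟩ <;> refine ⟨?_, ?_⟩ <;> grind

/-- Every nonempty finite set contains a vertex of valency at most `1` or a clean arc. -/
def HasLooseEndsOrArcs (n : ℕ) (G : SimpleGraph V) : Prop :=
  ∀ A : Finset V, A.Nonempty →
    (∃ v ∈ A, (nbrs G A v).card ≤ 1) ∨ ∃ x, IsCleanArc n G A x

theorem IsOpenGraph.hasLooseEndsOrArcs {n : ℕ} (hn : 3 ≤ n) {G : SimpleGraph V}
    (h : IsOpenGraph n G) : HasLooseEndsOrArcs n G := by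
  intro A hA
  refine (h A hA).imp ?_ ?_
  · rintro ⟨v, hv⟩
    rw [encard_neighborSet_induce] at hv
    exact ⟨v, v.2, by exact_mod_cast hv⟩
  · rintro ⟨a, b, p, hp, hl, hv⟩
    refine ⟨fun i => (p.getVert i : V), ?_, ?_, ?_, ?_⟩
    · intro i j hi hj hij
      exact hp.getVert_injOn (by simp; omega) (by simp; omega) (Subtype.ext hij)
    · intro i _
      exact (p.getVert i).2
    · intro i hi
      exact p.adj_getVert_succ (by omega)
    · intro i h1 h2
      have := hv i h1 (by omega)
      rw [encard_neighborSet_induce] at this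
      exact_mod_cast this

theorem IsCleanArc.nbrs_eq [DecidableEq V] {n : ℕ} {G : SimpleGraph V} {A : Finset V} {x : ℕ → V}
    (h : IsCleanArc n G A x) {i : ℕ} (h1 : 1 ≤ i) (h2 : i + 1 < n) :
    nbrs G A (x i) = {x (i - 1), x (i + 1)} := by
  symm
  apply Finset.eq_of_subset_of_card_le
  · intro y hy
    rw [mem_nbrs]
    rcases Finset.mem_insert.1 hy with rfl | hy
    · refine ⟨h.mem _ (by omega), ?_⟩
      have := h.adj (i - 1) (by omega)
      rw [Nat.sub_add_cancel h1] at this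
      exact this.symm
    · rw [Finset.mem_singleton.1 hy]
      exact ⟨h.mem _ h2, h.adj i h2⟩
  · rw [h.valency i h1 h2, Finset.card_pair]
    intro he
    have := h.inj _ _ (by omega) h2 he
    omega

theorem IsCleanArc.reverse {n : ℕ} {G : SimpleGraph V} {A : Finset V} {x : ℕ → V}
    (h : IsCleanArc n G A x) : IsCleanArc n G A fun i => x (n - 1 - i) where
  inj i j hi hj hij := by
    have := h.inj _ _ (by omega) (by omega) hij
    omega
  mem i hi := h.mem _ (by omega)
  adj i hi := by
    have := h.adj (n - 1 - (i + 1)) (by omega)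
    rw [show n - 1 - (i + 1) + 1 = n - 1 - i by omega] at this
    exact this.symm
  valency i h1 h2 := h.valency _ (by omega) (by omega)

theorem arcInterior_reverse (n : ℕ) (x : ℕ → V) :
    arcInterior n (fun i => x (n - 1 - i)) = arcInterior n x := by
  ext v
  simp only [mem_arcInterior]
  constructor
  · rintro ⟨i, h1, h2, h⟩
    exact ⟨n - 1 - i, by omega, by omega, h⟩
  · rintro ⟨i, h1, h2, h⟩
    exact ⟨n - 1 - i, by omega, by omega, by rw [← h]; congr 1; omega⟩

section Arcs

variable {n : ℕ} {G : SimpleGraph V} {A : Finset V} {x : ℕ → V}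

theorem IsCleanArc.notMem_arcInterior (h : IsCleanArc n G A x) {i : ℕ} (hi : i < n)
    (hi' : i = 0 ∨ i = n - 1) : x i ∉ arcInterior n x := by
  rw [mem_arcInterior]
  rintro ⟨j, h1, h2, hj⟩
  have := h.inj _ _ (by omega) hi hj
  omega

theorem IsCleanArc.arcInterior_subset (h : IsCleanArc n G A x) : arcInterior n x ⊆ A := by
  intro v hv
  obtain ⟨i, h1, h2, rfl⟩ := mem_arcInterior.1 hv
  exact h.mem i (by omega)

variable [DecidableEq V]

theorem IsCleanArc.card_arcInterior (h : IsCleanArc n G A x) : (arcInterior n x).card = n - 2 := by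
  have : arcInterior n x = (Finset.Ico 1 (n - 1)).image x := by
    ext; simp [arcInterior]
  rw [this, Finset.card_image_of_injOn, Nat.card_Ico]
  · omega
  · intro i hi j hj hij
    simp only [Finset.coe_Ico, Set.mem_Ico] at hi hj
    exact h.inj i j (by omega) (by omega) hij

theorem IsCleanArc.card_sdiff (h : IsCleanArc n G A x) :
    A.card = (A \ arcInterior n x).card + (n - 2) := by
  rw [Finset.card_sdiff_of_subset h.arcInterior_subset, h.card_arcInterior]
  have := Finset.card_le_card h.arcInterior_subset
  rw [h.card_arcInterior] at this
  omega

/-- Delete x₁, x₂, … in order: the first deletion destroys two edges, and each later one destroys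
only the edge to its successor, its predecessor being already gone. -/
theorem IsCleanArc.numEdges_sdiff (hn : 3 ≤ n) (h : IsCleanArc n G A x) :
    numEdges G A = numEdges G (A \ arcInterior n x) + (n - 1) := by
  have key : ∀ m, 1 ≤ m → m + 1 < n →
      numEdges G A = numEdges G (A \ (Finset.Icc 1 m).image x) + (m + 1) := by
    intro m h1 h2
    induction m, h1 using Nat.le_induction with
    | base =>
      have : A \ (Finset.Icc 1 1).image x = A.erase (x 1) := by
        ext; simp; tauto
      rw [this, numEdges_erase G (h.mem 1 (by omega)), h.valency 1 le_rfl h2]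
    | succ m hm ih =>
      rw [ih (by omega)]
      have hx : x (m + 1) ∈ A \ (Finset.Icc 1 m).image x := by
        rw [Finset.mem_sdiff, Finset.mem_image]
        refine ⟨h.mem _ (by omega), ?_⟩
        rintro ⟨j, hj, hjx⟩
        rw [Finset.mem_Icc] at hj
        have := h.inj _ _ (by omega) (by omega) hjx
        omega
      rw [numEdges_erase G hx]
      have e1 : (A \ (Finset.Icc 1 m).image x).erase (x (m + 1)) =
          A \ (Finset.Icc 1 (m + 1)).image x := by
        rw [← Finset.insert_Icc_right_eq_Icc_add_one (by omega), Finset.image_insert,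
          Finset.sdiff_insert]
      have e2 : nbrs G (A \ (Finset.Icc 1 m).image x) (x (m + 1)) = {x (m + 2)} := by
        have hN := h.nbrs_eq (i := m + 1) (by omega) h2
        ext y
        have hy : y ∈ nbrs G A (x (m + 1)) ↔ y = x m ∨ y = x (m + 2) := by
          rw [hN]; simp
        rw [mem_nbrs] at hy
        rw [mem_nbrs, Finset.mem_sdiff, Finset.mem_singleton]
        constructor
        · rintro ⟨⟨hA, hI⟩, hadj⟩
          rcases hy.1 ⟨hA, hadj⟩ with rfl | rfl
          · exact absurd (Finset.mem_image_of_mem x (Finset.mem_Icc.2 ⟨hm, le_rfl⟩)) hI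
          · rfl
        · rintro rfl
          have := hy.2 (Or.inr rfl)
          refine ⟨⟨this.1, ?_⟩, this.2⟩
          rw [Finset.mem_image]
          rintro ⟨j, hj, hjx⟩
          rw [Finset.mem_Icc] at hj
          have := h.inj _ _ (by omega) (by omega) hjx
          omega
      rw [e1, e2, Finset.card_singleton]
      omega
  have e : arcInterior n x = (Finset.Icc 1 (n - 2)).image x := by
    ext v
    rw [mem_arcInterior, Finset.mem_image]
    refine exists_congr fun i => ?_
    rw [Finset.mem_Icc]
    constructor
    · rintro ⟨h1, h2, h3⟩; exact ⟨⟨h1, by omega⟩, h3⟩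
    · rintro ⟨⟨h1, h2⟩, h3⟩; exact ⟨h1, by omega, h3⟩
  rw [e, key (n - 2) (by omega) (by omega)]
  omega

/-- The weights in δₙ are chosen for this cancellation: n-2 vertices of weight n-1 against n-1 edges
of weight n-2. -/
theorem IsCleanArc.delta_sdiff (hn : 3 ≤ n) (h : IsCleanArc n G A x) :
    delta n G A = delta n G (A \ arcInterior n x) := by
  rw [delta_eq, delta_eq, h.numEdges_sdiff hn, h.card_sdiff]
  push_cast [show 2 ≤ n by omega, show 1 ≤ n by omega]
  ring

theorem delta_erase (n : ℕ) (G : SimpleGraph V) {A : Finset V} {v : V} (hv : v ∈ A) :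
    delta n G A = delta n G (A.erase v) + ((n : ℤ) - 1) -
      ((n : ℤ) - 2) * (nbrs G A v).card := by
  have h1 := Finset.card_erase_add_one hv
  rw [delta_eq, delta_eq, numEdges_erase G hv, ← h1]
  push_cast
  ring

theorem delta_erase_lt (hn : 3 ≤ n) {v : V} (hv : v ∈ A) (h : (nbrs G A v).card ≤ 1) :
    delta n G (A.erase v) < delta n G A := by
  rw [delta_erase n G hv]
  have : ((nbrs G A v).card : ℤ) ≤ 1 := by exact_mod_cast h
  have h3 : (3 : ℤ) ≤ n := by exact_mod_cast hn
  nlinarith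

end Arcs

/-! ### Walks inside a set of vertices -/

/-- There is a walk of length at most `k` from `a` to `b` all of whose vertices are in `U`. -/
def WalkIn (G : SimpleGraph V) (U : Set V) (k : ℕ) (a b : V) : Prop :=
  ∃ p : G.Walk a b, p.length ≤ k ∧ ∀ x ∈ p.support, x ∈ U

namespace WalkIn

variable {G : SimpleGraph V} {U U' : Set V} {k l : ℕ} {a b c : V}

theorem refl (ha : a ∈ U) (k : ℕ) : WalkIn G U k a a :=
  ⟨.nil, by simp, by simpa using ha⟩

theorem mono (h : WalkIn G U k a b) (hU : U ⊆ U') (hk : k ≤ l) : WalkIn G U' l a b := by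
  obtain ⟨p, hp, hs⟩ := h
  exact ⟨p, hp.trans hk, fun x hx => hU (hs x hx)⟩

theorem mono_right (h : WalkIn G U k a b) (hk : k ≤ l) : WalkIn G U l a b :=
  h.mono subset_rfl hk

theorem symm (h : WalkIn G U k a b) : WalkIn G U k b a := by
  obtain ⟨p, hp, hs⟩ := h
  exact ⟨p.reverse, by simpa using hp, by simpa using hs⟩

theorem trans (h : WalkIn G U k a b) (h' : WalkIn G U l b c) : WalkIn G U (k + l) a c := by
  obtain ⟨p, hp, hs⟩ := h
  obtain ⟨q, hq, hs'⟩ := h'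
  refine ⟨p.append q, by rw [SimpleGraph.Walk.length_append]; omega, fun x hx => ?_⟩
  rcases (SimpleGraph.Walk.mem_support_append_iff p q).1 hx with h | h
  exacts [hs x h, hs' x h]

theorem of_adj (h : G.Adj a b) (ha : a ∈ U) (hb : b ∈ U) : WalkIn G U 1 a b :=
  ⟨h.toWalk, by simp, by simp [ha, hb]⟩

theorem eq_of_zero (h : WalkIn G U 0 a b) : a = b := by
  obtain ⟨p, hp, -⟩ := h
  exact SimpleGraph.Walk.eq_of_length_eq_zero (Nat.le_zero.1 hp)

end WalkIn

theorem exists_walk_of_seq {G : SimpleGraph V} (x : ℕ → V) (m : ℕ)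
    (h : ∀ i < m, G.Adj (x i) (x (i + 1))) :
    ∃ p : G.Walk (x 0) (x m), p.length = m ∧ p.support = (List.range (m + 1)).map x := by
  induction m with
  | zero => exact ⟨.nil, rfl, rfl⟩
  | succ m ih =>
    obtain ⟨p, hp, hs⟩ := ih fun i hi => h i (by omega)
    refine ⟨p.concat (h m (by omega)), by simp [hp], ?_⟩
    rw [SimpleGraph.Walk.support_concat, hs, List.range_succ (n := m + 1)]
    simp

theorem WalkIn.of_seq {G : SimpleGraph V} {U : Set V} (x : ℕ → V) {i j : ℕ} (hij : i ≤ j)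
    (h : ∀ l, i ≤ l → l < j → G.Adj (x l) (x (l + 1))) (hU : ∀ l, i ≤ l → l ≤ j → x l ∈ U) :
    WalkIn G U (j - i) (x i) (x j) := by
  obtain ⟨p, hp, hs⟩ := exists_walk_of_seq (G := G) (fun l => x (i + l)) (j - i)
    fun l hl => h (i + l) (by omega) (by omega)
  refine ⟨p.copy rfl (by congr 1; omega), by simp [hp], fun y hy => ?_⟩
  rw [SimpleGraph.Walk.support_copy, hs, List.mem_map] at hy
  obtain ⟨l, hl, rfl⟩ := hy
  rw [List.mem_range] at hl
  exact hU _ (by omega) (by omega)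

/-- Two distinct paths with the same ends have total length at least the girth. -/
theorem egirth_le_of_isPath_ne {G : SimpleGraph V} {a b : V} {p q : G.Walk a b} (hp : p.IsPath)
    (hq : q.IsPath) (hne : p ≠ q) : G.egirth ≤ (p.length + q.length : ℕ) := by
  classical
  let H : SimpleGraph V := SimpleGraph.fromEdgeSet {e | e ∈ p.edges ∨ e ∈ q.edges}
  have hHE : ∀ e, e ∈ p.edges ∨ e ∈ q.edges → e ∈ H.edgeSet := by
    intro e he
    rw [SimpleGraph.edgeSet_fromEdgeSet]
    refine ⟨he, ?_⟩
    have : e ∈ G.edgeSet := by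
      rcases he with he | he
      exacts [p.edges_subset_edgeSet he, q.edges_subset_edgeSet he]
    exact G.not_isDiag_of_mem_edgeSet this
  have hHG : H ≤ G := by
    intro v w h
    rw [SimpleGraph.fromEdgeSet_adj] at h
    rcases h.1 with h | h
    exacts [p.edges_subset_edgeSet h, q.edges_subset_edgeSet h]
  -- In a forest paths are unique, so the union of the two paths carries a cycle, no longer than
  -- their total number of edges.
  have hnot : ¬ H.IsAcyclic := by
    intro hac
    have := (hac.subsingleton_path a b).elim
      ⟨p.transfer H fun e he => hHE e (Or.inl he), hp.transfer _⟩
      ⟨q.transfer H fun e he => hHE e (Or.inr he), hq.transfer _⟩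
    have h2 := congrArg (fun r : H.Path a b => (r : H.Walk a b).support) this
    simp only [SimpleGraph.Walk.support_transfer] at h2
    exact hne (SimpleGraph.Walk.ext_support h2)
  obtain ⟨v, c, hc⟩ : ∃ v, ∃ c : H.Walk v v, c.IsCycle := by
    by_contra hcon
    push Not at hcon
    exact hnot fun v c hc => hcon v c hc
  have hlen : c.length ≤ p.length + q.length := by
    rw [← SimpleGraph.Walk.length_edges, ← SimpleGraph.Walk.length_edges,
      ← SimpleGraph.Walk.length_edges, ← List.length_append]
    rw [← List.toFinset_card_of_nodup hc.edges_nodup]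
    refine le_trans (Finset.card_le_card ?_) (List.toFinset_card_le _)
    intro e he
    rw [List.mem_toFinset] at he ⊢
    have := c.edges_subset_edgeSet he
    rw [SimpleGraph.edgeSet_fromEdgeSet] at this
    exact List.mem_append.2 this.1
  calc G.egirth ≤ H.egirth := SimpleGraph.egirth_anti hHG
    _ ≤ c.length := SimpleGraph.egirth_le_length hc
    _ ≤ _ := by exact_mod_cast hlen

/-- The vertices of a path of length `n - 1` between two vertices of `U` that are joined inside `U`
by a walk of length at most `n` all belong to `U`, if the girth is at least `2n`. -/
theorem mem_of_walkIn {n : ℕ} (hn : 1 ≤ n) {G : SimpleGraph V} (hg : ((2 * n : ℕ) : ℕ∞) ≤ G.egirth)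
    {U : Set V} {x : ℕ → V} (hinj : ∀ i j, i < n → j < n → x i = x j → i = j)
    (hadj : ∀ i, i + 1 < n → G.Adj (x i) (x (i + 1)))
    (hw : WalkIn G U n (x 0) (x (n - 1))) {i : ℕ} (hi : i < n) : x i ∈ U := by
  classical
  obtain ⟨q, hq, hU⟩ := hw
  obtain ⟨p, hp, hs⟩ := exists_walk_of_seq (G := G) x (n - 1) fun i hi => hadj i (by omega)
  have hpath : p.IsPath := by
    rw [SimpleGraph.Walk.isPath_def, hs]
    refine List.Nodup.map_on ?_ List.nodup_range
    intro i hi j hj hij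
    rw [List.mem_range] at hi hj
    exact hinj i j (by omega) (by omega) hij
  have hpq : p = q.bypass := by
    by_contra hne
    have h1 := hg.trans (egirth_le_of_isPath_ne hpath q.bypass_isPath hne)
    have h2 := q.length_bypass_le_length
    have h3 : 2 * n ≤ p.length + q.bypass.length := by exact_mod_cast h1
    omega
  have hmem : x i ∈ p.support := by
    rw [hs]
    exact List.mem_map_of_mem (List.mem_range.2 (by omega))
  rw [hpq] at hmem
  exact hU _ (q.support_bypass_subset_support hmem)

/-! ### Cycles -/

/-- A forest extends to a spanning tree of the complete graph on its vertices, so it has fewer edges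
than vertices. -/
theorem exists_isCycle_of_card_le {G : SimpleGraph V} {C : Finset V} (hC : C.Nonempty)
    (h : C.card ≤ numEdges G C) : ∃ a, ∃ c : G.Walk a a, c.IsCycle ∧ ∀ x ∈ c.support, x ∈ C := by
  classical
  by_cases hac : (G.induce (C : Set V)).IsAcyclic
  · exfalso
    have : Nonempty (C : Set V) := hC.coe_sort
    obtain ⟨T, hT, -, htree⟩ :=
      (SimpleGraph.connected_top (V := (C : Set V))).exists_isTree_le_of_le_of_isAcyclic
        (H := G.induce (C : Set V)) le_top hac
    have h1 := htree.card_edgeFinset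
    have h2 : numEdges G C ≤ T.edgeFinset.card := by
      rw [numEdges, ← Set.ncard_coe_finset, SimpleGraph.coe_edgeFinset]
      exact Set.ncard_le_ncard (SimpleGraph.edgeSet_mono ‹_›) (Set.toFinite _)
    simp only [Finset.coe_sort_coe, Fintype.card_coe] at h1
    omega
  · obtain ⟨v, c, hc⟩ : ∃ v, ∃ c : (G.induce (C : Set V)).Walk v v, c.IsCycle := by
      by_contra hcon
      push Not at hcon
      exact hac fun v c hc => hcon v c hc
    let φ := SimpleGraph.Embedding.induce (G := G) (C : Set V)
    refine ⟨_, c.map φ.toHom, hc.map φ.injective, ?_⟩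
    intro x hx
    rw [SimpleGraph.Walk.support_map, List.mem_map] at hx
    obtain ⟨y, -, rfl⟩ := hx
    exact y.2

theorem _root_.SimpleGraph.Walk.IsCycle.length_le_card {G : SimpleGraph V} {a : V}
    {c : G.Walk a a} (hc : c.IsCycle) {C : Finset V} (hC : ∀ x ∈ c.support, x ∈ C) :
    c.length ≤ C.card := by
  classical
  have h1 : c.support.tail.toFinset.card = c.length := by
    rw [List.toFinset_card_of_nodup hc.support_nodup, List.length_tail,
      SimpleGraph.Walk.length_support]
    rfl
  rw [← h1]
  refine Finset.card_le_card fun x hx => hC x ?_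
  exact List.mem_of_mem_tail (List.mem_toFinset.1 hx)

theorem _root_.SimpleGraph.Walk.IsCycle.mem_support_of_card_le {G : SimpleGraph V} {a : V}
    {c : G.Walk a a} (hc : c.IsCycle) {C : Finset V} (hC : ∀ x ∈ c.support, x ∈ C)
    (h : C.card ≤ c.length) {x : V} (hx : x ∈ C) : x ∈ c.support := by
  classical
  by_contra hcon
  have := hc.length_le_card (C := C.erase x) fun y hy =>
    Finset.mem_erase.2 ⟨by rintro rfl; exact hcon hy, hC y hy⟩
  have := Finset.card_erase_add_one hx
  omega

/-- Any three points of `U` lie on a closed walk of length at most `L` inside `U`. -/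
def HasPerimeterLE (G : SimpleGraph V) (U : Set V) (L : ℕ) : Prop :=
  ∀ p ∈ U, ∀ z ∈ U, ∀ y ∈ U, ∃ i j k, i + j + k ≤ L ∧
    WalkIn G U i p z ∧ WalkIn G U j z y ∧ WalkIn G U k y p

/-- Two points cut the closed walk into two pieces, and the shorter one has length at most L/2. The
odd bound also covers cycles of length 2n+1. -/
theorem HasPerimeterLE.walkIn {G : SimpleGraph V} {U : Set V} {L m : ℕ}
    (h : HasPerimeterLE G U L) (hL : L ≤ 2 * m + 1) {a b : V} (ha : a ∈ U) (hb : b ∈ U) :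
    WalkIn G U m a b := by
  obtain ⟨i, j, k, hs, h1, h2, -⟩ := h a ha b hb a ha
  by_cases hi : i ≤ m
  · exact h1.mono_right hi
  · exact h2.symm.mono_right (by omega)

/-- Start the closed walk at z and split it at y; the third point p lies on one of the two pieces
and splits that piece again. -/
theorem hasPerimeterLE_of_closed_walk {G : SimpleGraph V} {U : Set V} {a : V} (c : G.Walk a a)
    (hc : ∀ x, x ∈ c.support ↔ x ∈ U) : HasPerimeterLE G U c.length := by
  classical
  intro p hp z hz y hy
  have hz' := (hc z).2 hz
  let d := c.rotate z hz'
  have hd : ∀ x, x ∈ d.support ↔ x ∈ U := fun x => by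
    rw [← hc x]; exact c.mem_support_rotate_iff z hz'
  have hdl : d.length = c.length := by simp [d]
  have hsplit : ∀ {u v w : V} (q : G.Walk u v) (hw : w ∈ q.support), (∀ x ∈ q.support, x ∈ U) →
      ∃ (q1 : G.Walk u w) (q2 : G.Walk w v), q1.length + q2.length = q.length ∧
        (∀ x, x ∈ q.support ↔ x ∈ q1.support ∨ x ∈ q2.support) := by
    intro u v w q hw hq
    refine ⟨q.takeUntil w hw, q.dropUntil w hw, ?_, fun x => ?_⟩
    · rw [← SimpleGraph.Walk.length_append, SimpleGraph.Walk.take_spec]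
    · rw [← SimpleGraph.Walk.mem_support_append_iff, SimpleGraph.Walk.take_spec]
  obtain ⟨w1, w2, hl, hs⟩ := hsplit d ((hd y).2 hy) fun x hx => (hd x).1 hx
  have hU1 : ∀ x ∈ w1.support, x ∈ U := fun x hx => (hd x).1 ((hs x).2 (Or.inl hx))
  have hU2 : ∀ x ∈ w2.support, x ∈ U := fun x hx => (hd x).1 ((hs x).2 (Or.inr hx))
  rcases (hs p).1 ((hd p).2 hp) with h | h
  · obtain ⟨v1, v2, hl', hs'⟩ := hsplit w1 h hU1
    refine ⟨v1.length, w2.length, v2.length, by omega, WalkIn.symm ⟨v1, le_rfl, ?_⟩,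
      WalkIn.symm ⟨w2, le_rfl, hU2⟩, WalkIn.symm ⟨v2, le_rfl, ?_⟩⟩
    · exact fun x hx => hU1 x ((hs' x).2 (Or.inl hx))
    · exact fun x hx => hU1 x ((hs' x).2 (Or.inr hx))
  · obtain ⟨v1, v2, hl', hs'⟩ := hsplit w2 h hU2
    refine ⟨v2.length, w1.length, v1.length, by omega, ⟨v2, le_rfl, ?_⟩,
      ⟨w1, le_rfl, hU1⟩, ⟨v1, le_rfl, ?_⟩⟩
    · exact fun x hx => hU2 x ((hs' x).2 (Or.inr hx))
    · exact fun x hx => hU2 x ((hs' x).2 (Or.inl hx))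

/-! ### Open graphs of large girth with few vertices -/

/-- The possible shapes of a nonempty finite set `C` with `δₙ(C) ≤ 2n + 1` in an open graph of girth
at least `2n`: less edges than vertices; a cycle of length `2n`; a cycle of length `2n` with an
additional vertex `w`; a set in which all distances are at most `n`. -/
inductive SmallShape (n : ℕ) (G : SimpleGraph V) (C : Finset V) : Prop
  | sparse (h : numEdges G C + 1 ≤ C.card)
  | cycle (hc : C.card = 2 * n) (he : numEdges G C = 2 * n) (h : HasPerimeterLE G (C : Set V) (2 * n))
  | lollipop (C₀ : Finset V) (w z : V) (hc : C₀.card = 2 * n)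
      (h : HasPerimeterLE G (C₀ : Set V) (2 * n)) (hw : w ∉ C₀) (hz : z ∈ C₀) (hwz : G.Adj w z)
      (hC : ∀ x, x ∈ C ↔ x = w ∨ x ∈ C₀) (he : numEdges G C = 2 * n + 1)
  | small (he : numEdges G C ≤ C.card + 1) (hd : delta n G C = 2 * n + 1)
      (h : ∀ a ∈ C, ∀ b ∈ C, WalkIn G (C : Set V) n a b)

variable {n : ℕ} {G : SimpleGraph V} {C : Finset V}

theorem SmallShape.numEdges_le (h : SmallShape n G C) : numEdges G C ≤ C.card + 1 := by
  classical
  cases h with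
  | sparse h => omega
  | cycle hc he h => omega
  | lollipop C₀ w z hc h hw hz hwz hC he =>
    have : C = insert w C₀ := by ext x; rw [hC, Finset.mem_insert]
    have h2 := Finset.card_insert_of_notMem hw
    rw [← this] at h2
    omega
  | small he hd h => exact he

/-- A clean arc cannot join two points that are at distance at most `n` outside the arc. -/
theorem IsCleanArc.not_walkIn [DecidableEq V] (hn : 3 ≤ n)
    (hg : ((2 * n : ℕ) : ℕ∞) ≤ G.egirth) {x : ℕ → V} (hx : IsCleanArc n G C x) :
    ¬ WalkIn G ((C \ arcInterior n x : Finset V) : Set V) n (x 0) (x (n - 1)) := by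
  intro hw
  have h1 := mem_of_walkIn (by omega) hg hx.inj hx.adj hw (i := 1) (by omega)
  rw [Finset.mem_coe, Finset.mem_sdiff] at h1
  exact h1.2 (mem_arcInterior.2 ⟨1, le_rfl, by omega, rfl⟩)

/-- Adding an arc from `w` to a cycle of length `2n` with a pendant edge `(z, w)`. -/
theorem walkIn_of_theta {n : ℕ} (hn : 3 ≤ n) {G : SimpleGraph V} {C C₀ : Finset V} {x : ℕ → V}
    {z : V} (hC₀ : C₀ ⊆ C) (hper : HasPerimeterLE G (C₀ : Set V) (2 * n)) (hz : z ∈ C₀)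
    (hzx : G.Adj z (x 0)) (hmem : ∀ i < n, x i ∈ C) (hadj : ∀ i, i + 1 < n → G.Adj (x i) (x (i + 1)))
    (hy : x (n - 1) ∈ C₀) (hC : ∀ v ∈ C, v ∈ C₀ ∨ ∃ i < n, x i = v)
    (hno : ¬ WalkIn G (C₀ : Set V) (n - 1) z (x (n - 1))) :
    ∀ a ∈ C, ∀ b ∈ C, WalkIn G (C : Set V) n a b := by
  have hC₀' : (C₀ : Set V) ⊆ C := Finset.coe_subset.2 hC₀
  have hseq : ∀ i j, i ≤ j → j < n → WalkIn G (C : Set V) (j - i) (x i) (x j) := fun i j hij hj =>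
    WalkIn.of_seq x hij (fun l _ h2 => hadj l (by omega)) fun l _ h2 => hmem l (by omega)
  have hstart : ∀ i < n, WalkIn G (C : Set V) (i + 1) z (x i) := fun i hi =>
    ((WalkIn.of_adj hzx (hC₀ hz) (hmem 0 (by omega))).trans (hseq 0 i (by omega) hi)).mono_right
      (by omega)
  have hmix : ∀ p ∈ C₀, ∀ i < n, WalkIn G (C : Set V) n p (x i) := by
    intro p hp i hi
    obtain ⟨k, l, m, hsum, h1, h2, h3⟩ := hper p hp z hz _ hy
    -- Thus z and x (n-1) are opposite on the cycle, and any p on it satisfies k + m ≤ n.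
    have hl : n ≤ l := by
      by_contra hcon
      exact hno (h2.mono_right (by omega))
    -- The routes from p to x i through z and through x (n-1) have total length at most k + m + n ≤
    -- 2n, so one of them has length at most n.
    by_cases hk : k + (i + 1) ≤ n
    · exact ((h1.mono hC₀' le_rfl).trans (hstart i hi)).mono_right hk
    · exact ((h3.symm.mono hC₀' le_rfl).trans (hseq i (n - 1) (by omega) (by omega)).symm).mono_right
        (by omega)
  intro a ha b hb
  rcases hC a ha with ha' | ⟨i, hi, rfl⟩
  · rcases hC b hb with hb' | ⟨j, hj, rfl⟩
    · exact (hper.walkIn (by omega) ha' hb').mono hC₀' le_rfl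
    · exact hmix a ha' j hj
  · rcases hC b hb with hb' | ⟨j, hj, rfl⟩
    · exact (hmix b hb' i hi).symm
    · rcases le_total i j with hij | hij
      · exact (hseq i j hij hj).mono_right (by omega)
      · exact (hseq j i hij hi).symm.mono_right (by omega)

/-- The remainder has δₙ at most 2n, which excludes the last two shapes, where δₙ = 2n+1. Over a
cycle v cannot be isolated, since δₙ would then be 3n-1; so it hangs from the cycle by one edge. -/
theorem SmallShape.of_erase [DecidableEq V] (hn : 3 ≤ n) (hd : delta n G C ≤ 2 * n + 1) {v : V}
    (hv : v ∈ C) (hv1 : (nbrs G C v).card ≤ 1) (h : SmallShape n G (C.erase v)) :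
    SmallShape n G C := by
  have hlt := delta_erase_lt hn hv hv1
  have hcard := Finset.card_erase_add_one hv
  have hedge := numEdges_erase G hv
  cases h with
  | sparse h => exact .sparse (by omega)
  | cycle hc he h =>
    have h0 : (nbrs G C v).card ≠ 0 := by
      intro h0
      have h1 := delta_erase n G hv
      rw [h0, delta_eq n G (C.erase v), hc, he] at h1
      push_cast at h1
      have : (3 : ℤ) ≤ n := by exact_mod_cast hn
      nlinarith
    obtain ⟨z, hz⟩ := Finset.card_pos.1 (Nat.pos_of_ne_zero h0)
    rw [mem_nbrs] at hz
    refine .lollipop (C.erase v) v z hc h (Finset.notMem_erase v C)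
      (Finset.mem_erase.2 ⟨hz.2.ne', hz.1⟩) hz.2 (fun x => ?_) (by omega)
    rw [Finset.mem_erase]
    by_cases hxv : x = v
    · simp [hxv, hv]
    · simp [hxv]
  | lollipop C₀ w z hc h hw hz hwz hC he =>
    exfalso
    have hC' : C.erase v = insert w C₀ := by ext x; rw [hC, Finset.mem_insert]
    rw [delta_eq, he, hC', Finset.card_insert_of_notMem hw, hc] at hlt
    push_cast at hlt
    linarith
  | small he hd' h => linarith

/-- A set with as many edges as vertices. -/
theorem SmallShape.of_numEdges_eq [DecidableEq V] (hn : 3 ≤ n)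
    (hg : ((2 * n : ℕ) : ℕ∞) ≤ G.egirth) (hC : C.Nonempty) (hd : delta n G C ≤ 2 * n + 1)
    (he : numEdges G C = C.card)
    (ih : ∀ D ⊂ C, D.Nonempty → delta n G D ≤ 2 * n + 1 → SmallShape n G D) :
    SmallShape n G C := by
  -- With equally many edges and vertices δₙ is the cardinality, so C has at most 2n+1 points, while
  -- its cycle has length at least 2n: at most one point is missed.
  have hdel : delta n G C = C.card := by rw [delta_eq, he]; ring
  have hcard : C.card ≤ 2 * n + 1 := by
    rw [hdel] at hd; exact_mod_cast hd
  obtain ⟨a, c, hc, hs⟩ := exists_isCycle_of_card_le hC he.ge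
  have hl1 : 2 * n ≤ c.length := by
    exact_mod_cast hg.trans (SimpleGraph.egirth_le_length hc)
  have hl2 := hc.length_le_card hs
  by_cases hlc : C.card ≤ c.length
  · have hper : HasPerimeterLE G (C : Set V) c.length :=
      hasPerimeterLE_of_closed_walk c fun x => ⟨hs x, hc.mem_support_of_card_le hs hlc⟩
    by_cases h2 : C.card = 2 * n
    · exact .cycle h2 (he.trans h2) (by rwa [show c.length = 2 * n by omega] at hper)
    · refine .small (by omega) ?_ fun a ha b hb => hper.walkIn (by omega) ha hb
      rw [hdel, show C.card = 2 * n + 1 by omega]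
      push_cast; ring
  · obtain ⟨w, hw, hwc⟩ : ∃ w ∈ C, w ∉ c.support := by
      by_contra hcon
      push Not at hcon
      have : C ⊆ c.support.tail.toFinset := by
        intro x hx
        have h1 := hcon x hx
        rw [List.mem_toFinset]
        rw [← SimpleGraph.Walk.cons_tail_support] at h1
        rcases List.mem_cons.1 h1 with rfl | h1
        · exact SimpleGraph.Walk.end_mem_tail_support hc.not_nil
        · exact h1
      have h3 := (Finset.card_le_card this).trans (List.toFinset_card_le _)
      rw [List.length_tail, SimpleGraph.Walk.length_support] at h3
      omega
    have hs' : ∀ x ∈ c.support, x ∈ C.erase w := fun x hx =>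
      Finset.mem_erase.2 ⟨by rintro rfl; exact hwc hx, hs x hx⟩
    have hcw := Finset.card_erase_add_one hw
    have hcw' : (C.erase w).card = 2 * n := by omega
    have hper : HasPerimeterLE G (C.erase w : Set V) c.length := by
      have := hasPerimeterLE_of_closed_walk (U := ((C.erase w : Finset V) : Set V)) c fun x =>
        ⟨hs' x, hc.mem_support_of_card_le hs' (by omega)⟩
      simpa using this
    have hew := numEdges_erase G hw
    -- If w were isolated, the other 2n points would span 2n+1 edges with δₙ = n+2, which fits none
    -- of the shapes.
    have hnb : (nbrs G C w).card ≠ 0 := by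
      intro h0
      have he' : numEdges G (C.erase w) = 2 * n + 1 := by omega
      have hdw : delta n G (C.erase w) = n + 2 := by
        rw [delta_eq, he', hcw']; push_cast; ring
      have hn' : (3 : ℤ) ≤ n := by exact_mod_cast hn
      have := ih (C.erase w) (Finset.erase_ssubset hw) (Finset.card_pos.1 (by omega))
        (by rw [hdw]; linarith)
      cases this with
      | sparse h => omega
      | cycle hc he h => omega
      | lollipop C₀ w' z hc h hw' hz hwz hC he'' =>
        have hC' : C.erase w = insert w' C₀ := by ext x; rw [hC, Finset.mem_insert]
        rw [hC', Finset.card_insert_of_notMem hw'] at hcw'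
        omega
      | small he hd' h => rw [hdw] at hd'; linarith
    obtain ⟨z, hz⟩ := Finset.card_pos.1 (Nat.pos_of_ne_zero hnb)
    rw [mem_nbrs] at hz
    refine .lollipop (C.erase w) w z hcw' ?_ (Finset.notMem_erase w C)
      (Finset.mem_erase.2 ⟨hz.2.ne', hz.1⟩) hz.2 (fun x => ?_) (by omega)
    · rw [show c.length = 2 * n by omega] at hper
      simpa using hper
    · rw [Finset.mem_erase]
      by_cases hxv : x = w
      · simp [hxv, hw]
      · simp [hxv]

/-- An arc raises edges minus vertices by one and keeps δₙ. Over a sparse set the result is sparse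
or has as many edges as vertices. Over a cycle, or a set with distances at most n, the girth forbids
the arc. Over a cycle with pendant vertex w, one end of the arc must be w and the other must be
opposite to z, giving a theta graph. -/
theorem SmallShape.of_sdiff_arc [DecidableEq V] (hn : 3 ≤ n)
    (hg : ((2 * n : ℕ) : ℕ∞) ≤ G.egirth) (hC : C.Nonempty) (hd : delta n G C ≤ 2 * n + 1)
    {x : ℕ → V} (hx : IsCleanArc n G C x)
    (ih : ∀ D ⊂ C, D.Nonempty → delta n G D ≤ 2 * n + 1 → SmallShape n G D) :
    SmallShape n G C := by
  have hmem0 : x 0 ∈ C \ arcInterior n x :=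
    Finset.mem_sdiff.2 ⟨hx.mem 0 (by omega), hx.notMem_arcInterior (by omega) (Or.inl rfl)⟩
  have hmem1 : x (n - 1) ∈ C \ arcInterior n x :=
    Finset.mem_sdiff.2 ⟨hx.mem _ (by omega), hx.notMem_arcInterior (by omega) (Or.inr rfl)⟩
  have hss : C \ arcInterior n x ⊂ C :=
    Finset.sdiff_ssubset hx.arcInterior_subset
      ⟨x 1, mem_arcInterior.2 ⟨1, le_rfl, by omega, rfl⟩⟩
  have hdel := hx.delta_sdiff hn
  have hcard := hx.card_sdiff
  have hedge := hx.numEdges_sdiff hn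
  cases ih _ hss ⟨_, hmem0⟩ (hdel ▸ hd) with
  | sparse h =>
    by_cases h' : numEdges G C + 1 ≤ C.card
    · exact .sparse h'
    · exact SmallShape.of_numEdges_eq hn hg hC hd (by omega) ih
  | cycle hc he h => exact absurd (h.walkIn (by omega) hmem0 hmem1) (hx.not_walkIn hn hg)
  | small he hd h => exact absurd (h _ hmem0 _ hmem1) (hx.not_walkIn hn hg)
  | lollipop C₀ w z hc h hw hz hwz hC' he =>
    have hCeq : C \ arcInterior n x = insert w C₀ := by ext y; rw [hC', Finset.mem_insert]
    have hsub : C₀ ⊆ C := fun y hy => (Finset.mem_sdiff.1 ((hC' y).2 (Or.inr hy))).1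
    have hsub' : (C₀ : Set V) ⊆ ((C \ arcInterior n x : Finset V) : Set V) := by
      intro y hy
      exact (hC' y).2 (Or.inr hy)
    have hc1 : (C \ arcInterior n x).card = 2 * n + 1 := by
      rw [hCeq, Finset.card_insert_of_notMem hw, hc]
    -- the case of an arc that starts at `w`
    have main : ∀ y : ℕ → V, IsCleanArc n G C y → arcInterior n y = arcInterior n x →
        y 0 = w → y (n - 1) ∈ C₀ → SmallShape n G C := by
      intro y hy hyx hy0 hy1
      refine .small (by omega) ?_ ?_
      · rw [hdel, delta_eq, he, hc1]; push_cast; ring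
      · refine walkIn_of_theta hn hsub h hz (by rw [hy0]; exact hwz.symm) hy.mem hy.adj hy1 ?_ ?_
        · intro v hv
          by_cases hvi : v ∈ arcInterior n y
          · obtain ⟨i, h1, h2, h3⟩ := mem_arcInterior.1 hvi
            exact Or.inr ⟨i, by omega, h3⟩
          · rcases (hC' v).1 (Finset.mem_sdiff.2 ⟨hv, hyx ▸ hvi⟩) with rfl | h'
            · exact Or.inr ⟨0, by omega, hy0⟩
            · exact Or.inl h'
        · intro hcon
          apply hy.not_walkIn hn hg
          rw [hyx, hy0]
          exact ((WalkIn.of_adj hwz ((hC' w).2 (Or.inl rfl)) ((hC' z).2 (Or.inr hz))).trans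
            (hcon.mono hsub' le_rfl)).mono_right (by omega)
    have hne : x 0 ≠ x (n - 1) := fun hcon => by
      have := hx.inj _ _ (by omega) (by omega) hcon
      omega
    rcases (hC' _).1 hmem0 with h0 | h0
    · rcases (hC' _).1 hmem1 with h1 | h1
      · exact absurd (h0.trans h1.symm) hne
      · exact main x hx rfl h0 h1
    · rcases (hC' _).1 hmem1 with h1 | h1
      · refine main _ hx.reverse (arcInterior_reverse n x) (by simpa using h1) ?_
        simpa using h0
      · exact absurd ((h.walkIn (by omega) h0 h1).mono hsub' le_rfl) (hx.not_walkIn hn hg)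

theorem smallShape_of_delta_le (hn : 3 ≤ n) (ho : HasLooseEndsOrArcs n G)
    (hg : ((2 * n : ℕ) : ℕ∞) ≤ G.egirth) (C : Finset V) (hC : C.Nonempty)
    (hd : delta n G C ≤ 2 * n + 1) : SmallShape n G C := by
  classical
  induction C using Finset.strongInduction with
  | H C ih =>
    rcases ho C hC with ⟨v, hv, hv1⟩ | ⟨x, hx⟩
    · rcases (C.erase v).eq_empty_or_nonempty with he | he
      · have h1 := numEdges_erase G hv
        have h2 := Finset.card_erase_add_one hv
        have h3 : nbrs G C v = ∅ := by
          rw [Finset.eq_empty_iff_forall_notMem]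
          intro w hw
          rw [mem_nbrs] at hw
          have : w ∈ C.erase v := Finset.mem_erase.2 ⟨hw.2.ne', hw.1⟩
          simp [he] at this
        rw [he, numEdges_empty, h3, Finset.card_empty] at h1
        exact .sparse (by omega)
      · exact .of_erase hn hd hv hv1
          (ih _ (Finset.erase_ssubset hv) he ((delta_erase_lt hn hv hv1).le.trans hd))
    · exact .of_sdiff_arc hn hg hC hd hx ih

/-- Finite sets `C` with `δₙ(C) ≤ 2n + 1` have less than `3n` elements. -/
theorem card_lt_of_delta_le (hn : 3 ≤ n) (ho : HasLooseEndsOrArcs n G)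
    (hg : ((2 * n : ℕ) : ℕ∞) ≤ G.egirth) (C : Finset V) (hd : delta n G C ≤ 2 * n + 1) :
    C.card < 3 * n := by
  rcases C.eq_empty_or_nonempty with rfl | hC
  · simp; omega
  have h := (smallShape_of_delta_le hn ho hg C hC hd).numEdges_le
  rw [delta_eq] at hd
  have h' : (numEdges G C : ℤ) ≤ C.card + 1 := by exact_mod_cast h
  have hn' : (3 : ℤ) ≤ n := by exact_mod_cast hn
  -- From δₙ(C) = |C| + (n-2)(|C| - |E|) ≥ |C| - (n-2) and δₙ(C) ≤ 2n+1 one gets |C| ≤ 3n-1.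
  have : (C.card : ℤ) < 3 * n := by nlinarith
  exact_mod_cast this

/-! ### Copies of finite sets inside elementary substructures -/

/-- Every finite set `R` has a copy inside `T` over any finite subset `P` of `T`. -/
def HasCopies (G : SimpleGraph V) (T : Set V) : Prop :=
  ∀ P R : Finset V, (∀ x ∈ P, x ∈ T) → ∃ φ : V → V, (∀ x ∈ P, φ x = x) ∧ (∀ x ∈ R, φ x ∈ T) ∧
    ∀ x y, (x ∈ P ∨ x ∈ R) → (y ∈ P ∨ y ∈ R) →
      (φ x = φ y ↔ x = y) ∧ (G.Adj (φ x) (φ y) ↔ G.Adj x y)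

-- The equalities and adjacencies among the points of P and R form a finite conjunction of literals.
-- Existentially quantifying the variables of R leaves a formula with parameters P, true in the
-- whole structure and hence in S; its witnesses are the copy.
open FirstOrder FirstOrder.Language in
theorem hasCopies_of_elementarySubstructure {G : SimpleGraph V} (C : G.Coloring Bool)
    (S : @ElementarySubstructure bipLang V (bipStructure C)) :
    HasCopies G (@SetLike.coe _ _ (@ElementarySubstructure.instSetLike bipLang V (bipStructure C)) S) := by
  classical
  let _ := bipStructure C
  intro P R hP
  let α := {x // x ∈ P}
  let β := {x // x ∈ R}
  let e : α ⊕ β → V := Sum.elim Subtype.val Subtype.val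
  let adjF : α ⊕ β → α ⊕ β → bipLang.Formula (α ⊕ β) := fun u v =>
    Relations.formula₂ (L := bipLang) (BipRel.adj : bipLang.Relations 2)
      (Term.var u) (Term.var v)
  let eqF : α ⊕ β → α ⊕ β → bipLang.Formula (α ⊕ β) := fun u v =>
    Term.equal (Term.var u) (Term.var v)
  let lit : (α ⊕ β) × (α ⊕ β) → bipLang.Formula (α ⊕ β) := fun p =>
    (if e p.1 = e p.2 then eqF p.1 p.2 else ∼(eqF p.1 p.2)) ⊓
      (if G.Adj (e p.1) (e p.2) then adjF p.1 p.2 else ∼(adjF p.1 p.2))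
  have hadj : ∀ (w : α ⊕ β → V) u v, (adjF u v).Realize w ↔ G.Adj (w u) (w v) := by
    intro w u v
    simp only [adjF]
    exact Iff.rfl
  have heq : ∀ (w : α ⊕ β → V) u v, (eqF u v).Realize w ↔ w u = w v := by
    intro w u v
    simp only [eqF, Formula.realize_equal, Term.realize_var]
  have hlit : ∀ (w : α ⊕ β → V), (Formula.iInf lit).Realize w ↔
      ∀ u v, (w u = w v ↔ e u = e v) ∧ (G.Adj (w u) (w v) ↔ G.Adj (e u) (e v)) := by
    intro w
    rw [Formula.realize_iInf, Prod.forall]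
    refine forall₂_congr fun u v => ?_
    simp only [lit, Formula.realize_inf]
    refine and_congr ?_ ?_
    · split_ifs with h
      · rw [heq]; tauto
      · rw [Formula.realize_not, heq]; tauto
    · split_ifs with h
      · rw [hadj]; tauto
      · rw [Formula.realize_not, hadj]; tauto
  have hV : ((Formula.iInf lit).iExs β).Realize (S.subtype ∘ fun x : α => (⟨x.1, hP x.1 x.2⟩ : S)) := by
    rw [Formula.realize_iExs]
    exact ⟨Subtype.val, (hlit _).2 fun u v => ⟨by cases u <;> cases v <;> rfl,
      by cases u <;> cases v <;> rfl⟩⟩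
  rw [S.subtype.map_formula, Formula.realize_iExs] at hV
  obtain ⟨b, hb⟩ := hV
  rw [← S.subtype.map_formula, hlit] at hb
  set w : α ⊕ β → V := ⇑S.subtype ∘ Sum.elim (fun x : α => (⟨x.1, hP x.1 x.2⟩ : S)) b with hw
  let φ : V → V := fun x => if hx : x ∈ P then x else if hx : x ∈ R then b ⟨x, hx⟩ else x
  have hφP : ∀ x ∈ P, φ x = x := fun x hx => by simp [φ, hx]
  have hidx : ∀ x, (x ∈ P ∨ x ∈ R) → ∃ u, e u = x ∧ w u = φ x := by
    intro x hx
    by_cases hxP : x ∈ P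
    · exact ⟨Sum.inl ⟨x, hxP⟩, rfl, by rw [hφP x hxP]; rfl⟩
    · have hxR := hx.resolve_left hxP
      exact ⟨Sum.inr ⟨x, hxR⟩, rfl, by simp only [φ, dif_neg hxP, dif_pos hxR]; rfl⟩
  refine ⟨φ, hφP, fun x hx => ?_, fun x y hx hy => ?_⟩
  · by_cases hxP : x ∈ P
    · rw [hφP x hxP]; exact hP x hxP
    · simp only [φ, dif_neg hxP, dif_pos hx]
      exact (b ⟨x, hx⟩).2
  · obtain ⟨u, hu, hu'⟩ := hidx x hx
    obtain ⟨v, hv, hv'⟩ := hidx y hy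
    have := hb u v
    rwa [hu, hv, hu', hv'] at this

/-! ### Openness over a set with copies -/

section Copies

variable {n : ℕ} {G : SimpleGraph V} {T : Set V}

/-- Three copies of `B` over `B ∩ T` that are disjoint outside `T`. -/
theorem HasCopies.exists_three (hT : HasCopies G T) (B : Finset V) :
    ∃ φ : Fin 3 → V → V, (∀ i, ∀ x ∈ B, x ∈ T → φ i x = x) ∧
      (∀ i, ∀ x ∈ B, ∀ y ∈ B, (φ i x = φ i y ↔ x = y) ∧ (G.Adj (φ i x) (φ i y) ↔ G.Adj x y)) ∧
      ∀ i j, ∀ x ∈ B, x ∉ T → ∀ y ∈ B, y ∉ T → φ i x = φ j y → i = j := by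
  classical
  let P := B.filter (· ∈ T)
  let R := B.filter (· ∉ T)
  have hB : ∀ x ∈ B, x ∈ P ∨ x ∈ R := fun x hx => by
    by_cases h : x ∈ T <;> simp [P, R, hx, h]
  obtain ⟨f, hf1, hf2, hf3⟩ := hT P R fun x hx => (Finset.mem_filter.1 hx).2
  -- The second copy is taken over the first one as well: g fixes f(R) pointwise and is injective,
  -- so its image of R avoids f(R).
  obtain ⟨g, hg1, hg2, hg3⟩ := hT (P ∪ R.image f) R fun x hx => by
    rcases Finset.mem_union.1 hx with h | h
    · exact (Finset.mem_filter.1 h).2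
    · obtain ⟨y, hy, rfl⟩ := Finset.mem_image.1 h
      exact hf2 y hy
  have hB' : ∀ x ∈ B, x ∈ P ∪ R.image f ∨ x ∈ R := fun x hx =>
    (hB x hx).imp (fun h => Finset.mem_union_left _ h) id
  have hfT : ∀ x ∈ B, x ∉ T → f x ∈ T := fun x hx hxT => hf2 x (Finset.mem_filter.2 ⟨hx, hxT⟩)
  have hgT : ∀ x ∈ B, x ∉ T → g x ∈ T := fun x hx hxT => hg2 x (Finset.mem_filter.2 ⟨hx, hxT⟩)
  have hfg : ∀ x ∈ B, x ∉ T → ∀ y ∈ B, y ∉ T → f x ≠ g y := by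
    intro x hx hxT y hy hyT h
    have hmem : f x ∈ P ∪ R.image f := Finset.mem_union_right _
      (Finset.mem_image_of_mem f (Finset.mem_filter.2 ⟨hx, hxT⟩))
    have := (hg3 (f x) y (Or.inl hmem) (hB' y hy)).1.1 (by rw [hg1 _ hmem, h])
    exact hyT (this ▸ hfT x hx hxT)
  refine ⟨![id, f, g], ?_, ?_, ?_⟩
  · intro i x hx hxT
    have hxP : x ∈ P := Finset.mem_filter.2 ⟨hx, hxT⟩
    fin_cases i
    · rfl
    · exact hf1 x hxP
    · exact hg1 x (Finset.mem_union_left _ hxP)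
  · intro i x hx y hy
    fin_cases i
    · exact ⟨Iff.rfl, Iff.rfl⟩
    · exact hf3 x y (hB x hx) (hB y hy)
    · exact hg3 x y (hB' x hx) (hB' y hy)
  · intro i j x hx hxT y hy hyT h
    fin_cases i <;> fin_cases j <;> first | rfl | exfalso
    · exact hxT ((show x = f y from h) ▸ hfT y hy hyT)
    · exact hxT ((show x = g y from h) ▸ hgT y hy hyT)
    · exact hyT ((show f x = y from h) ▸ hfT x hx hxT)
    · exact hfg x hx hxT y hy hyT h
    · exact hyT ((show g x = y from h) ▸ hgT x hx hxT)
    · exact hfg y hy hyT x hx hxT h.symm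

/-- An open graph is open over any set with copies. -/
theorem HasCopies.looseEnd_or_arc (hn : 3 ≤ n) (ho : HasLooseEndsOrArcs n G) (hT : HasCopies G T)
    {B : Finset V} (hB : ∃ x ∈ B, x ∉ T) :
    (∃ v ∈ B, v ∉ T ∧ (nbrs G B v).card ≤ 1) ∨
      ∃ x, IsCleanArc n G B x ∧ ∀ i, 1 ≤ i → i + 1 < n → x i ∉ T := by
  classical
  obtain ⟨φ, hφT, hφ, hdisj⟩ := hT.exists_three B
  -- `B'` consists of the elements outside `T` and their neighbours
  let B' := B.filter fun x => x ∈ T → ∃ r ∈ B, r ∉ T ∧ G.Adj x r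
  let D := Finset.univ.biUnion fun i => B'.image (φ i)
  have hB'B : B' ⊆ B := Finset.filter_subset _ _
  have hRB' : ∀ x ∈ B, x ∉ T → x ∈ B' := fun x hx hxT =>
    Finset.mem_filter.2 ⟨hx, fun h => absurd h hxT⟩
  have hD : ∀ v, v ∈ D ↔ ∃ i, ∃ x ∈ B', φ i x = v := by simp [D]
  have hnB' : ∀ x ∈ B, x ∉ T → nbrs G B x ⊆ B' := by
    intro x hx hxT y hy
    rw [mem_nbrs] at hy
    exact Finset.mem_filter.2 ⟨hy.1, fun _ => ⟨x, hx, hxT, hy.2.symm⟩⟩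
  have hsub : ∀ i, ∀ x ∈ B, x ∉ T → (nbrs G B x).image (φ i) ⊆ nbrs G D (φ i x) := by
    intro i x hx hxT v hv
    obtain ⟨y, hy, rfl⟩ := Finset.mem_image.1 hv
    refine mem_nbrs.2 ⟨(hD _).2 ⟨i, y, hnB' x hx hxT hy, rfl⟩, ?_⟩
    rw [mem_nbrs] at hy
    exact (hφ i x hx y hy.1).2.2 hy.2
  have hcard : ∀ i, ∀ x, ((nbrs G B x).image (φ i)).card = (nbrs G B x).card := by
    intro i x
    refine Finset.card_image_of_injOn fun y hy z hz h => ?_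
    exact (hφ i y (mem_nbrs.1 hy).1 z (mem_nbrs.1 hz).1).1.1 h
  -- A boundary point x is fixed by all three copies and is adjacent to the three distinct images of
  -- its neighbour r outside T. So it is neither a loose end nor interior to a clean arc.
  have hbdry : ∀ x ∈ B', x ∈ T → 3 ≤ (nbrs G D x).card := by
    intro x hx hxT
    obtain ⟨hxB, h⟩ := Finset.mem_filter.1 hx
    obtain ⟨r, hr, hrT, hadj⟩ := h hxT
    have hinj : Function.Injective fun i => φ i r := fun i j hij => hdisj i j r hr hrT r hr hrT hij
    have h3 : (Finset.univ.image fun i => φ i r).card = 3 := by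
      rw [Finset.card_image_of_injective _ hinj]; rfl
    rw [← h3]
    refine Finset.card_le_card fun v hv => ?_
    obtain ⟨i, -, rfl⟩ := Finset.mem_image.1 hv
    refine mem_nbrs.2 ⟨(hD _).2 ⟨i, r, hRB' r hr hrT, rfl⟩, ?_⟩
    have := (hφ i x hxB r hr).2.2 hadj
    rwa [hφT i x hxB hxT] at this
  obtain ⟨r₀, hr₀, hr₀T⟩ := hB
  by_contra hcon
  rw [not_or] at hcon
  obtain ⟨hloose, harc⟩ := hcon
  have hval : ∀ x ∈ B, x ∉ T → 2 ≤ (nbrs G B x).card := by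
    intro x hx hxT
    by_contra h
    exact hloose ⟨x, hx, hxT, by omega⟩
  rcases ho D ⟨_, (hD _).2 ⟨0, r₀, hRB' r₀ hr₀ hr₀T, rfl⟩⟩ with ⟨v, hv, hv1⟩ | ⟨y, hy⟩
  · obtain ⟨i, x, hx, rfl⟩ := (hD v).1 hv
    by_cases hxT : x ∈ T
    · rw [hφT i x (hB'B hx) hxT] at hv1
      have := hbdry x hx hxT
      omega
    · have h1 := Finset.card_le_card (hsub i x (hB'B hx) hxT)
      rw [hcard] at h1
      have := hval x (hB'B hx) hxT
      omega
  · -- interior points of the arc are outside `T`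
    have hint : ∀ i, 1 ≤ i → i + 1 < n → ∀ j, ∀ x ∈ B', φ j x = y i → x ∉ T := by
      intro i h1 h2 j x hx hxy hxT
      have := hbdry x hx hxT
      rw [← hφT j x (hB'B hx) hxT, hxy, hy.valency i h1 h2] at this
      omega
    -- Edges between different copies are possible in D. At an interior point they do not occur: its
    -- valency is 2, and two neighbours already lie in its own copy. Hence the whole arc stays in
    -- one copy.
    have hnb : ∀ i, 1 ≤ i → i + 1 < n → ∀ j, ∀ x ∈ B', φ j x = y i →
        nbrs G D (y i) = (nbrs G B x).image (φ j) := by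
      intro i h1 h2 j x hx hxy
      have hxT := hint i h1 h2 j x hx hxy
      symm
      rw [← hxy]
      refine Finset.eq_of_subset_of_card_le (hsub j x (hB'B hx) hxT) ?_
      rw [hcard, hxy, hy.valency i h1 h2]
      exact hval x (hB'B hx) hxT
    have hstep : ∀ i, 1 ≤ i → i + 1 < n → ∀ j, (∃ x ∈ B', φ j x = y i) →
        ∀ v ∈ D, G.Adj (y i) v → ∃ x ∈ B', φ j x = v := by
      rintro i h1 h2 j ⟨x, hx, hxy⟩ v hv hadj
      have : v ∈ nbrs G D (y i) := mem_nbrs.2 ⟨hv, hadj⟩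
      rw [hnb i h1 h2 j x hx hxy] at this
      obtain ⟨z, hz, rfl⟩ := Finset.mem_image.1 this
      exact ⟨z, hnB' x (hB'B hx) (hint i h1 h2 j x hx hxy) hz, rfl⟩
    obtain ⟨j, hj⟩ := (hD (y 1)).1 (hy.mem 1 (by omega))
    have hup : ∀ i, 1 ≤ i → i < n → ∃ x ∈ B', φ j x = y i := by
      intro i h1
      induction i, h1 using Nat.le_induction with
      | base => exact fun _ => hj
      | succ i h1 ih =>
        exact fun h2 => hstep i h1 h2 j (ih (by omega)) _ (hy.mem _ h2) (hy.adj i h2)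
    have hall : ∀ i, ∃ x, i < n → x ∈ B' ∧ φ j x = y i := by
      intro i
      by_cases hi : i < n
      · rcases Nat.eq_zero_or_pos i with rfl | h0
        · obtain ⟨x, hx⟩ := hstep 1 le_rfl (by omega) j hj (y 0) (hy.mem 0 hi)
            (hy.adj 0 (by omega)).symm
          exact ⟨x, fun _ => hx⟩
        · obtain ⟨x, hx⟩ := hup i h0 hi
          exact ⟨x, fun _ => hx⟩
      · exact ⟨r₀, fun h => absurd h hi⟩
    choose x hx using hall
    refine harc ⟨x, ⟨?_, ?_, ?_, ?_⟩, ?_⟩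
    · intro i k hi hk hik
      exact hy.inj i k hi hk (by rw [← (hx i hi).2, ← (hx k hk).2, hik])
    · exact fun i hi => hB'B (hx i hi).1
    · intro i hi
      have h1 := hx i (by omega)
      have h2 := hx (i + 1) hi
      rw [← (hφ j _ (hB'B h1.1) _ (hB'B h2.1)).2, h1.2, h2.2]
      exact hy.adj i hi
    · intro i h1 h2
      have h3 := hx i (by omega)
      rw [← hcard j, ← hnb i h1 h2 j _ h3.1 h3.2, hy.valency i h1 h2]
    · intro i h1 h2
      have h3 := hx i (by omega)
      exact hint i h1 h2 j _ h3.1 h3.2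

/-- Arcs between elements of a set with copies are contained in that set. -/
theorem HasCopies.arc_mem (hn : 3 ≤ n) (hg : ((2 * n : ℕ) : ℕ∞) ≤ G.egirth) (hT : HasCopies G T)
    {B : Finset V} {x : ℕ → V} (hx : IsCleanArc n G B x) (h0 : x 0 ∈ T) (h1 : x (n - 1) ∈ T)
    {i : ℕ} (hi : i < n) : x i ∈ T := by
  classical
  obtain ⟨φ, hφP, hφR, hφ⟩ := hT {x 0, x (n - 1)} ((Finset.range n).image x) (by simp [h0, h1])
  have hmem : ∀ i < n, x i ∈ (Finset.range n).image x := fun i hi =>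
    Finset.mem_image_of_mem x (Finset.mem_range.2 hi)
  refine mem_of_walkIn (by omega) hg hx.inj hx.adj (U := T) ?_ hi
  have := WalkIn.of_seq (G := G) (U := T) (fun i => φ (x i)) (Nat.zero_le (n - 1))
    (fun l _ hl => (hφ _ _ (Or.inr (hmem l (by omega))) (Or.inr (hmem (l + 1) (by omega)))).2.2
      (hx.adj l (by omega)))
    (fun l _ hl => hφR _ (hmem l (by omega)))
  rw [hφP (x 0) (by simp), hφP (x (n - 1)) (by simp)] at this
  exact this.mono_right (by omega)

-- Strip B by loose ends and arcs found outside T, never touching B ∩ T. Loose ends decrease δₙ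
-- strictly. An arc removal cannot be the last one: its ends would lie in T, and `HasCopies.arc_mem`
-- would put the interior there too.
open Classical in
theorem HasCopies.delta_filter_lt (hn : 3 ≤ n) (ho : HasLooseEndsOrArcs n G)
    (hg : ((2 * n : ℕ) : ℕ∞) ≤ G.egirth) (hT : HasCopies G T)
    (B : Finset V) (hB : ∃ x ∈ B, x ∉ T) :
    delta n G (B.filter (· ∈ T)) < delta n G B := by
  induction B using Finset.strongInduction with
  | H B ih =>
    have key : ∀ B' ⊂ B, (∀ x ∈ B, x ∈ T → x ∈ B') → delta n G B' ≤ delta n G B →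
        ((∀ x ∈ B', x ∈ T) → delta n G B' < delta n G B) →
        delta n G (B.filter (· ∈ T)) < delta n G B := by
      intro B' hss hin hle hlt
      have hf : B.filter (· ∈ T) = B'.filter (· ∈ T) := by
        ext x
        simp only [Finset.mem_filter]
        exact ⟨fun h => ⟨hin x h.1 h.2, h.2⟩, fun h => ⟨hss.subset h.1, h.2⟩⟩
      rw [hf]
      by_cases hB' : ∀ x ∈ B', x ∈ T
      · rw [Finset.filter_true_of_mem hB']
        exact hlt hB'
      · push Not at hB'
        exact (ih B' hss hB').trans_le hle
    rcases hT.looseEnd_or_arc hn ho hB with ⟨v, hv, hvT, hv1⟩ | ⟨x, hx, hxT⟩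
    · have hlt := delta_erase_lt hn hv hv1
      exact key (B.erase v) (Finset.erase_ssubset hv)
        (fun x hx hxT => Finset.mem_erase.2 ⟨by rintro rfl; exact hvT hxT, hx⟩) hlt.le fun _ => hlt
    · refine key (B \ arcInterior n x) (Finset.sdiff_ssubset hx.arcInterior_subset
        ⟨x 1, mem_arcInterior.2 ⟨1, le_rfl, by omega, rfl⟩⟩) ?_ (hx.delta_sdiff hn).ge ?_
      · intro z hz hzT
        refine Finset.mem_sdiff.2 ⟨hz, fun h => ?_⟩
        obtain ⟨i, h1, h2, rfl⟩ := mem_arcInterior.1 h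
        exact hxT i h1 h2 hzT
      · intro h
        exfalso
        refine hxT 1 le_rfl (by omega) (hT.arc_mem hn hg hx (h _ ?_) (h _ ?_) (by omega))
        · exact Finset.mem_sdiff.2 ⟨hx.mem 0 (by omega), hx.notMem_arcInterior (by omega) (Or.inl rfl)⟩
        · exact Finset.mem_sdiff.2 ⟨hx.mem _ (by omega), hx.notMem_arcInterior (by omega) (Or.inr rfl)⟩

theorem HasCopies.eq_univ (hn : 3 ≤ n) (ho : HasLooseEndsOrArcs n G)
    (hg : ((2 * n : ℕ) : ℕ∞) ≤ G.egirth)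
    (hcof : ∀ A₀ : Finset V, ∃ A : Finset V, A₀ ⊆ A ∧ delta n G A = 2 * (n : ℤ) + 2)
    (hcard : ∃ A : Finset V, 3 * n ≤ A.card) (hT : HasCopies G T) : T = Set.univ := by
  classical
  by_contra hne
  obtain ⟨v, hv⟩ := (Set.ne_univ_iff_exists_notMem T).1 hne
  obtain ⟨A, hA⟩ := hcard
  obtain ⟨φ, -, hφT, hφ⟩ := hT ∅ A (by simp)
  -- B meets T in at least 3n points, by the copy of A, and v makes the drop in δₙ strict.
  obtain ⟨B, hB, hdB⟩ := hcof (insert v (A.image φ))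
  have hlt := hT.delta_filter_lt hn ho hg B ⟨v, hB (Finset.mem_insert_self _ _), hv⟩
  have h1 := card_lt_of_delta_le hn ho hg (B.filter (· ∈ T)) (by linarith)
  have h2 : (A.image φ).card = A.card := Finset.card_image_of_injOn fun x hx y hy h =>
    (hφ x y (Or.inr hx) (Or.inr hy)).1.1 h
  have h3 : A.image φ ⊆ B.filter (· ∈ T) := by
    intro x hx
    refine Finset.mem_filter.2 ⟨hB (Finset.mem_insert_of_mem hx), ?_⟩
    obtain ⟨y, hy, rfl⟩ := Finset.mem_image.1 hx
    exact hφT y hy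
  have h4 := Finset.card_le_card h3
  omega

end Copies

/-! ### Minimality of open generalized polygons -/

/-- Minimality of open graphs of girth at least `2n` in which the finite sets `A` with
`δₙ(A) = 2n + 2` are cofinal. -/
theorem isMinimal_of_cofinal {n : ℕ} (hn : 3 ≤ n) {G : SimpleGraph V} (C : G.Coloring Bool)
    (ho : HasLooseEndsOrArcs n G) (hg : ((2 * n : ℕ) : ℕ∞) ≤ G.egirth)
    (hcof : ∀ A₀ : Finset V, ∃ A : Finset V, A₀ ⊆ A ∧ delta n G A = 2 * (n : ℤ) + 2)
    (hcard : ∃ A : Finset V, 3 * n ≤ A.card) : IsMinimal C := by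
  intro S
  have := (hasCopies_of_elementarySubstructure C S).eq_univ hn ho hg hcof hcard
  exact SetLike.coe_injective this

/-- Were the graph finite, openness of its full vertex set would yield a vertex of valency at most
2; an arc has an interior vertex because n ≥ 3. -/
theorem infinite_of_hasLooseEndsOrArcs {n : ℕ} (hn : 3 ≤ n) {G : SimpleGraph V}
    (ho : HasLooseEndsOrArcs n G) (ht : ∀ v : V, 3 ≤ (G.neighborSet v).encard) [Nonempty V] :
    Infinite V := by
  classical
  rw [← not_finite_iff_infinite]
  intro hfin
  have := Fintype.ofFinite V
  have hval : ∀ v, 3 ≤ (nbrs G Finset.univ v).card := by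
    intro v
    have h1 : (nbrs G Finset.univ v : Set V) = G.neighborSet v := by
      ext w; simp [mem_nbrs]
    have h2 := ht v
    rw [← h1, Set.encard_coe_eq_coe_finsetCard] at h2
    exact_mod_cast h2
  rcases ho Finset.univ Finset.univ_nonempty with ⟨v, -, hv⟩ | ⟨x, hx⟩
  · have := hval v
    omega
  · have := hval (x 1)
    rw [hx.valency 1 le_rfl (by omega)] at this
    omega

theorem isMinimal_of_isGeneralizedPolygon {n : ℕ} (hn : 3 ≤ n) {G : SimpleGraph V}
    (C : G.Coloring Bool) (hG : IsGeneralizedPolygon n G) (ho : IsOpenGraph n G)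
    (hcof : ∀ A₀ : Finset V, ∃ A : Finset V, A₀ ⊆ A ∧ delta n G A = 2 * (n : ℤ) + 2) :
    IsMinimal C := by
  have ho' := ho.hasLooseEndsOrArcs hn
  have hne : Nonempty V := by
    by_contra hcon
    rw [not_nonempty_iff] at hcon
    have := hG.diameter
    rw [SimpleGraph.ediam_eq_zero_of_subsingleton] at this
    have h0 : (0 : ℕ) = n := by exact_mod_cast this
    omega
  have hinf := infinite_of_hasLooseEndsOrArcs hn ho' hG.thick
  obtain ⟨A, hA⟩ := Infinite.exists_subset_card_eq V (3 * n)
  exact isMinimal_of_cofinal hn C ho' hG.girth.ge hcof ⟨A, hA.ge⟩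

/-! ### Graphs built by adding arcs -/

/-- A description of `G` as a union of stages `Uₖ`, where `Uₖ₊₁` arises from `Uₖ` by adding new arcs
between some pairs of vertices that are at distance more than `n` in `Uₖ`. -/
structure ArcTower (n : ℕ) (G : SimpleGraph V) where
  /-- the stages -/
  U : ℕ → Set V
  /-- the arcs that are added to a stage -/
  Arc : ℕ → Type v
  /-- the vertices of an arc, including its ends -/
  arc : ∀ {k}, Arc k → ℕ → V
  cover : ∀ x, ∃ k, x ∈ U k
  mem_succ : ∀ {k x}, x ∈ U (k + 1) ↔
    x ∈ U k ∨ ∃ (s : Arc k) (i : ℕ), 1 ≤ i ∧ i + 1 < n ∧ arc s i = x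
  first_mem : ∀ {k} (s : Arc k), arc s 0 ∈ U k
  last_mem : ∀ {k} (s : Arc k), arc s (n - 1) ∈ U k
  notMem : ∀ {k} (s : Arc k) {i}, 1 ≤ i → i + 1 < n → arc s i ∉ U k
  inj : ∀ {k} (s t : Arc k) {i j}, 1 ≤ i → i + 1 < n → 1 ≤ j → j + 1 < n →
    arc s i = arc t j → s = t ∧ i = j
  adj_iff : ∀ {k} (s : Arc k) {i y}, 1 ≤ i → i + 1 < n → y ∈ U (k + 1) →
    (G.Adj (arc s i) y ↔ y = arc s (i - 1) ∨ y = arc s (i + 1))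
  far : ∀ {k} (s : Arc k), ¬ WalkIn G (U k) n (arc s 0) (arc s (n - 1))
  ends_ne : ∀ {k} (s t : Arc k), s ≠ t → arc s 0 = arc t 0 → arc s (n - 1) ≠ arc t (n - 1)
  ends_ne' : ∀ {k} (s t : Arc k), arc s 0 = arc t (n - 1) → arc s (n - 1) ≠ arc t 0
  base : ∀ A : Finset V, A.Nonempty → (A : Set V) ⊆ U 0 → ∃ v ∈ A, (nbrs G A v).card ≤ 1

namespace ArcTower

variable {n : ℕ} {G : SimpleGraph V} (Γ : ArcTower.{u, v} n G) {k : ℕ}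

theorem subset_succ (k : ℕ) : Γ.U k ⊆ Γ.U (k + 1) := fun _ hx => Γ.mem_succ.2 (Or.inl hx)

theorem monotone : Monotone Γ.U := monotone_nat_of_le_succ Γ.subset_succ

theorem exists_stage (A : Finset V) : ∃ k, (A : Set V) ⊆ Γ.U k := by
  choose f hf using Γ.cover
  exact ⟨A.sup f, fun x hx => Γ.monotone (Finset.le_sup hx) (hf x)⟩

theorem arc_zero_ne (s : Γ.Arc k) : Γ.arc s 0 ≠ Γ.arc s (n - 1) := fun h =>
  Γ.far s (h ▸ WalkIn.refl (Γ.first_mem s) n)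

theorem arc_cases (hn : 3 ≤ n) (s : Γ.Arc k) {i : ℕ} (hi : i < n) :
    (i = 0 ∨ i = n - 1) ∧ Γ.arc s i ∈ Γ.U k ∨ (1 ≤ i ∧ i + 1 < n) ∧ Γ.arc s i ∉ Γ.U k := by
  by_cases h : 1 ≤ i ∧ i + 1 < n
  · exact Or.inr ⟨h, Γ.notMem s h.1 h.2⟩
  · rcases (by omega : i = 0 ∨ i = n - 1) with rfl | rfl
    · exact Or.inl ⟨Or.inl rfl, Γ.first_mem s⟩
    · exact Or.inl ⟨Or.inr rfl, Γ.last_mem s⟩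

theorem arc_inj (hn : 3 ≤ n) (s : Γ.Arc k) {i j : ℕ} (hi : i < n) (hj : j < n)
    (h : Γ.arc s i = Γ.arc s j) : i = j := by
  rcases Γ.arc_cases hn s hi with ⟨h1, h2⟩ | ⟨h1, h2⟩ <;>
    rcases Γ.arc_cases hn s hj with ⟨h3, h4⟩ | ⟨h3, h4⟩
  · have := Γ.arc_zero_ne s
    rcases h1 with rfl | rfl <;> rcases h3 with rfl | rfl
    · rfl
    · exact absurd h this
    · exact absurd h.symm this
    · rfl
  · exact absurd (h ▸ h2) h4
  · exact absurd (h ▸ h4) h2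
  · exact (Γ.inj s s h1.1 h1.2 h3.1 h3.2 h).2

theorem arc_mem_succ (hn : 3 ≤ n) (s : Γ.Arc k) {i : ℕ} (hi : i < n) :
    Γ.arc s i ∈ Γ.U (k + 1) := by
  rcases Γ.arc_cases hn s hi with ⟨-, h⟩ | ⟨h, -⟩
  · exact Γ.subset_succ k h
  · exact Γ.mem_succ.2 (Or.inr ⟨s, i, h.1, h.2, rfl⟩)

theorem arc_adj (hn : 3 ≤ n) (s : Γ.Arc k) {i : ℕ} (hi : i + 1 < n) :
    G.Adj (Γ.arc s i) (Γ.arc s (i + 1)) := by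
  rcases Nat.eq_zero_or_pos i with rfl | h0
  · exact ((Γ.adj_iff s le_rfl (by omega) (Γ.arc_mem_succ hn s (by omega))).2 (Or.inl rfl)).symm
  · exact (Γ.adj_iff s h0 hi (Γ.arc_mem_succ hn s hi)).2 (Or.inr rfl)

theorem nbrs_arc [DecidableEq V] (s : Γ.Arc k) {A : Finset V} (hA : (A : Set V) ⊆ Γ.U (k + 1))
    {i : ℕ} (h1 : 1 ≤ i) (h2 : i + 1 < n) :
    nbrs G A (Γ.arc s i) = ({Γ.arc s (i - 1), Γ.arc s (i + 1)} : Finset V).filter (· ∈ A) := by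
  ext y
  rw [mem_nbrs, Finset.mem_filter, Finset.mem_insert, Finset.mem_singleton, and_comm]
  exact and_congr_left fun hy => Γ.adj_iff s h1 h2 (hA hy)

theorem isCleanArc (hn : 3 ≤ n) (s : Γ.Arc k) {A : Finset V} (hA : (A : Set V) ⊆ Γ.U (k + 1))
    (h : ∀ i < n, Γ.arc s i ∈ A) : IsCleanArc n G A (Γ.arc s) where
  inj _ _ hi hj hij := Γ.arc_inj hn s hi hj hij
  mem := h
  adj _ hi := Γ.arc_adj hn s hi
  valency i h1 h2 := by
    classical
    rw [Γ.nbrs_arc s hA h1 h2, Finset.filter_true_of_mem, Finset.card_pair]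
    · intro he
      have := Γ.arc_inj hn s (by omega) h2 he
      omega
    · intro y hy
      rcases Finset.mem_insert.1 hy with rfl | hy
      · exact h _ (by omega)
      · rw [Finset.mem_singleton.1 hy]
        exact h _ h2

/-- A point of A that is new in the last stage is interior to an arc of that stage. Either some
interior point of this arc in A lacks a neighbour in A and is loose, or membership in A spreads
along the arc in both directions and the arc is clean. -/
theorem hasLooseEndsOrArcs (Γ : ArcTower.{u, v} n G) (hn : 3 ≤ n) : HasLooseEndsOrArcs n G := by
  classical
  intro A hA
  obtain ⟨k, hk⟩ := Γ.exists_stage A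
  induction k with
  | zero => exact Or.inl (Γ.base A hA hk)
  | succ k ih =>
    by_cases hAk : (A : Set V) ⊆ Γ.U k
    · exact ih hAk
    · obtain ⟨x, hxA, hx⟩ := Set.not_subset.1 hAk
      obtain ⟨s, i, h1, h2, rfl⟩ := (Γ.mem_succ.1 (hk hxA)).resolve_left hx
      by_contra hcon
      rw [not_or] at hcon
      have hboth : ∀ j, 1 ≤ j → j + 1 < n → Γ.arc s j ∈ A →
          Γ.arc s (j - 1) ∈ A ∧ Γ.arc s (j + 1) ∈ A := by
        intro j h1 h2 hj
        by_contra hnot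
        refine hcon.1 ⟨_, hj, ?_⟩
        rw [Γ.nbrs_arc s hk h1 h2, Finset.filter_insert, Finset.filter_singleton]
        split_ifs with h3 h4
        · exact absurd ⟨h3, h4⟩ hnot
        all_goals simp
      refine hcon.2 ⟨_, Γ.isCleanArc hn s hk fun j hj => ?_⟩
      rcases le_total i j with hij | hij
      · induction j, hij using Nat.le_induction with
        | base => exact hxA
        | succ j hij ih => exact (hboth j (by omega) hj (ih (by omega))).2
      · induction hij using Nat.decreasingInduction with
        | self => exact hxA
        | of_succ j hji ih =>
          have := (hboth (j + 1) (by omega) (by omega) (ih (by omega))).1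
          simpa using this

/-! #### The girth -/

/-- Truncated lower bound for the length of a walk from the first end of the arc `s` that avoids
the interior of `s`. -/
def Near (s : Γ.Arc k) (x : V) (l : ℕ) : Prop :=
  WalkIn G (Γ.U k) l (Γ.arc s 0) x ∨
    (n - 1 ≤ l ∧ ∃ t, t ≠ s ∧ (Γ.arc t 0 = Γ.arc s 0 ∧ Γ.arc t (n - 1) = x ∨
      Γ.arc t (n - 1) = Γ.arc s 0 ∧ Γ.arc t 0 = x)) ∨ n ≤ l

variable {Γ}

theorem Near.mono {s : Γ.Arc k} {x : V} {l m : ℕ} (h : Γ.Near s x l) (hlm : l ≤ m) :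
    Γ.Near s x m := by
  rcases h with h | ⟨h, h'⟩ | h
  · exact Or.inl (h.mono_right hlm)
  · exact Or.inr (Or.inl ⟨h.trans hlm, h'⟩)
  · exact Or.inr (Or.inr (h.trans hlm))

theorem Near.of_adj {s : Γ.Arc k} {x y : V} {l : ℕ} (h : Γ.Near s x l) (hx : x ∈ Γ.U k)
    (hy : y ∈ Γ.U k) (hxy : G.Adj x y) : Γ.Near s y (l + 1) := by
  rcases h with h | ⟨h, -⟩ | h
  · exact Or.inl (h.trans (WalkIn.of_adj hxy hx hy))
  · exact Or.inr (Or.inr (by omega))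
  · exact Or.inr (Or.inr (by omega))

/-- A walk in the old stage is too long by `far`; a single other arc, of length n-1, cannot have the
same two ends in either orientation. -/
theorem Near.last {s : Γ.Arc k} {l : ℕ} (h : Γ.Near s (Γ.arc s (n - 1)) l) : n ≤ l := by
  rcases h with h | ⟨-, t, hts, ⟨h1, h2⟩ | ⟨h1, h2⟩⟩ | h
  · by_contra hcon
    exact Γ.far s (h.mono_right (by omega))
  · exact absurd h2 (Γ.ends_ne t s hts h1)
  · exact absurd h1 (Γ.ends_ne' t s h2)
  · exact h

/-- Bounds matter only up to n, so crossing an arc after at least one step is already enough. The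
case l = 0 is an arc that starts at the first end of s, and is why the middle alternative of `Near`
exists. -/
theorem Near.to_last (hn : 3 ≤ n) {s t : Γ.Arc k} (hts : t ≠ s) {l : ℕ}
    (h : Γ.Near s (Γ.arc t 0) l) : Γ.Near s (Γ.arc t (n - 1)) (l + (n - 1)) := by
  rcases Nat.eq_zero_or_pos l with rfl | h0
  · rcases h with h | ⟨h, -⟩ | h
    · exact Or.inr (Or.inl ⟨by omega, t, hts, Or.inl ⟨h.eq_of_zero.symm, rfl⟩⟩)
    all_goals omega
  · exact Or.inr (Or.inr (by omega))

theorem Near.to_first (hn : 3 ≤ n) {s t : Γ.Arc k} (hts : t ≠ s) {l : ℕ}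
    (h : Γ.Near s (Γ.arc t (n - 1)) l) : Γ.Near s (Γ.arc t 0) (l + (n - 1)) := by
  rcases Nat.eq_zero_or_pos l with rfl | h0
  · rcases h with h | ⟨h, -⟩ | h
    · exact Or.inr (Or.inl ⟨by omega, t, hts, Or.inr ⟨h.eq_of_zero.symm, rfl⟩⟩)
    all_goals omega
  · exact Or.inr (Or.inr (by omega))

variable (Γ)

/-- Lower bound for the length `m` of a walk in the stage `k + 1` from the `i`-th vertex of the
arc `s` to `x` that does not use the edge between the `i`-th and the `i + 1`-st vertex of `s`. -/
inductive Reach (s : Γ.Arc k) (i : ℕ) (x : V) (m : ℕ) : Prop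
  | stage (l : ℕ) (hx : x ∈ Γ.U k) (hl : l + i ≤ m) (h : Γ.Near s x l)
  | left (j : ℕ) (h1 : 1 ≤ j) (hj : j ≤ i) (hx : x = Γ.arc s j) (hm : i ≤ m + j)
  | right (j : ℕ) (hj : i < j) (h2 : j + 1 < n) (hx : x = Γ.arc s j) (hm : i + n + (n - 1 - j) ≤ m)
  | fromFirst (t : Γ.Arc k) (j l : ℕ) (ht : t ≠ s) (h1 : 1 ≤ j) (h2 : j + 1 < n)
      (hx : x = Γ.arc t j) (h : Γ.Near s (Γ.arc t 0) l) (hm : l + j + i ≤ m)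
  | fromLast (t : Γ.Arc k) (j l : ℕ) (ht : t ≠ s) (h1 : 1 ≤ j) (h2 : j + 1 < n)
      (hx : x = Γ.arc t j) (h : Γ.Near s (Γ.arc t (n - 1)) l) (hm : l + (n - 1 - j) + i ≤ m)

theorem Reach.step (hn : 3 ≤ n) {s : Γ.Arc k} {i : ℕ} (hi : i + 1 < n) {x y : V} {m : ℕ}
    (h : Γ.Reach s i x m) (hx : x ∈ Γ.U (k + 1)) (hy : y ∈ Γ.U (k + 1)) (hxy : G.Adj x y)
    (he : s(x, y) ≠ s(Γ.arc s i, Γ.arc s (i + 1))) : Γ.Reach s i y (m + 1) := by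
  -- the two neighbours of an interior point
  have hnext : ∀ (t : Γ.Arc k) j, 1 ≤ j → j + 1 < n → x = Γ.arc t j →
      y = Γ.arc t (j - 1) ∨ y = Γ.arc t (j + 1) := by
    rintro t j h1 h2 rfl
    exact (Γ.adj_iff t h1 h2 hy).1 hxy
  cases h with
  | stage l hxk hl h =>
    rcases Γ.mem_succ.1 hy with hyk | ⟨t, j, h1, h2, rfl⟩
    · exact .stage (l + 1) hyk (by omega) (h.of_adj hxk hyk hxy)
    · rcases (Γ.adj_iff t h1 h2 hx).1 hxy.symm with hxj | hxj
      · have hj : j = 1 := by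
          by_contra hj
          exact Γ.notMem t (i := j - 1) (by omega) (by omega) (hxj ▸ hxk)
        subst hj
        by_cases hts : t = s
        · subst hts
          refine .left 1 le_rfl ?_ rfl (by omega)
          by_contra hcon
          obtain rfl : i = 0 := by omega
          exact he (by rw [hxj])
        · exact .fromFirst t 1 l hts h1 h2 rfl (by simpa [hxj] using h) (by omega)
      · have hj : j + 1 = n - 1 := by
          by_contra hj
          exact Γ.notMem t (i := j + 1) (by omega) (by omega) (hxj ▸ hxk)
        rw [hj] at hxj
        subst hxj
        by_cases hts : t = s
        · subst hts
          -- Entering s backwards requires having reached its last end, at cost at least n; this is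
          -- the summand n in `right`.
          have hl' := h.last
          refine .right j ?_ h2 rfl (by omega)
          by_contra hcon
          obtain rfl : i = j := by omega
          exact he (by rw [Sym2.eq_swap, hj])
        · exact .fromLast t j l hts h1 h2 rfl h (by omega)
  | left j h1 hj hxj hm =>
    rcases hnext s j h1 (by omega) hxj with rfl | rfl
    · by_cases hj1 : j = 1
      · subst hj1
        exact .stage 0 (Γ.first_mem s) (by omega) (Or.inl (WalkIn.refl (Γ.first_mem s) 0))
      · exact .left (j - 1) (by omega) (by omega) rfl (by omega)
    · refine .left (j + 1) (by omega) ?_ rfl (by omega)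
      by_contra hcon
      obtain rfl : j = i := by omega
      exact he (by rw [hxj])
  | right j hj h2 hxj hm =>
    rcases hnext s j (by omega) h2 hxj with rfl | rfl
    · refine .right (j - 1) ?_ (by omega) rfl (by omega)
      by_contra hcon
      obtain rfl : j = i + 1 := by omega
      exact he (by rw [hxj, Sym2.eq_swap]; rfl)
    · by_cases hj1 : j + 1 = n - 1
      · rw [hj1]
        exact .stage n (Γ.last_mem s) (by omega) (Or.inr (Or.inr le_rfl))
      · exact .right (j + 1) (by omega) (by omega) rfl (by omega)
  | fromFirst t j l ht h1 h2 hxj h hm =>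
    rcases hnext t j h1 h2 hxj with rfl | rfl
    · by_cases hj1 : j = 1
      · subst hj1
        exact .stage l (Γ.first_mem t) (by omega) h
      · exact .fromFirst t (j - 1) l ht (by omega) (by omega) rfl h (by omega)
    · by_cases hj1 : j + 1 = n - 1
      · rw [hj1]
        exact .stage _ (Γ.last_mem t) (by omega) (h.to_last hn ht)
      · exact .fromFirst t (j + 1) l ht (by omega) (by omega) rfl h (by omega)
  | fromLast t j l ht h1 h2 hxj h hm =>
    rcases hnext t j h1 h2 hxj with rfl | rfl
    · by_cases hj1 : j = 1
      · subst hj1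
        exact .stage _ (Γ.first_mem t) (by omega) (h.to_first hn ht)
      · exact .fromLast t (j - 1) l ht (by omega) (by omega) rfl h (by omega)
    · by_cases hj1 : j + 1 = n - 1
      · rw [hj1]
        exact .stage l (Γ.last_mem t) (by omega) h
      · exact .fromLast t (j + 1) l ht (by omega) (by omega) rfl h (by omega)

theorem Reach.walk (hn : 3 ≤ n) {s : Γ.Arc k} {i : ℕ} (hi : i + 1 < n) {x y : V} (p : G.Walk x y)
    (hp : ∀ z ∈ p.support, z ∈ Γ.U (k + 1)) (he : s(Γ.arc s i, Γ.arc s (i + 1)) ∉ p.edges)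
    {m : ℕ} (h : Γ.Reach s i x m) : Γ.Reach s i y (m + p.length) := by
  induction p generalizing m with
  | nil => exact h
  | cons hadj p ih =>
    rw [SimpleGraph.Walk.edges_cons, List.mem_cons, not_or] at he
    rw [SimpleGraph.Walk.length_cons, ← add_assoc, add_right_comm]
    refine ih (fun z hz => hp z (by simp [hz])) he.2 ?_
    exact h.step Γ hn hi (hp _ (by simp)) (hp _ (by simp)) hadj (Ne.symm he.1)

/-- A detour around one edge of s must go back i steps to the first end, spend at least n outside s,
and come back n-2-i steps from the last end: 2n-2 in total. -/
theorem two_mul_le_length (hn : 3 ≤ n) (s : Γ.Arc k) {i : ℕ} (hi : i + 1 < n)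
    (p : G.Walk (Γ.arc s i) (Γ.arc s (i + 1))) (hp : ∀ z ∈ p.support, z ∈ Γ.U (k + 1))
    (he : s(Γ.arc s i, Γ.arc s (i + 1)) ∉ p.edges) : 2 * n - 2 ≤ p.length := by
  have h0 : Γ.Reach s i (Γ.arc s i) 0 := by
    rcases Nat.eq_zero_or_pos i with rfl | h
    · exact .stage 0 (Γ.first_mem s) le_rfl (Or.inl (WalkIn.refl (Γ.first_mem s) 0))
    · exact .left i h le_rfl rfl (by omega)
  have h1 := h0.walk Γ hn hi p hp he
  rw [zero_add] at h1
  have hnot : 1 ≤ i + 1 ∧ i + 1 + 1 < n ∨ i + 1 = n - 1 := by omega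
  cases h1 with
  | stage l hx hl h =>
    rcases hnot with h' | h'
    · exact absurd hx (Γ.notMem s h'.1 h'.2)
    · rw [h'] at h
      have := h.last
      omega
  | left j h1 hj hx hm =>
    have := Γ.arc_inj hn s hi (by omega) hx
    omega
  | right j hj h2 hx hm =>
    have := Γ.arc_inj hn s hi (by omega) hx
    omega
  | fromFirst t j l ht h1 h2 hx h hm =>
    rcases hnot with h' | h'
    · exact absurd (Γ.inj s t h'.1 h'.2 h1 h2 hx).1.symm ht
    · rw [h'] at hx
      exact absurd (hx ▸ Γ.last_mem s) (Γ.notMem t h1 h2)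
  | fromLast t j l ht h1 h2 hx h hm =>
    rcases hnot with h' | h'
    · exact absurd (Γ.inj s t h'.1 h'.2 h1 h2 hx).1.symm ht
    · rw [h'] at hx
      exact absurd (hx ▸ Γ.last_mem s) (Γ.notMem t h1 h2)

theorem le_egirth (Γ : ArcTower.{u, v} n G) (hn : 3 ≤ n) (C : G.Coloring Bool) : ((2 * n : ℕ) : ℕ∞) ≤ G.egirth := by
  classical
  rw [SimpleGraph.le_egirth]
  intro a c hc
  have hlen : Even c.length := (C.even_length_iff_congr c).2 Iff.rfl
  -- Closed walks in a bipartite graph have even length, so this bound improves by one.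
  suffices h : 2 * n - 1 ≤ c.length by
    have : 2 * n ≤ c.length := by
      obtain ⟨r, hr⟩ := hlen
      omega
    exact_mod_cast this
  obtain ⟨k, hk⟩ := Γ.exists_stage c.support.toFinset
  replace hk : ∀ x ∈ c.support, x ∈ Γ.U k := fun x hx => hk (by simpa using hx)
  induction k with
  | zero =>
    exfalso
    obtain ⟨v, hv, hv1⟩ := Γ.base c.support.toFinset ⟨a, by simp⟩
      fun x hx => hk x (by simpa using hx)
    rw [List.mem_toFinset] at hv
    have h2 := hc.ncard_neighborSet_toSubgraph_eq_two hv
    have h3 : c.toSubgraph.neighborSet v ⊆ (nbrs G c.support.toFinset v : Set V) := by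
      intro w hw
      have hw' : c.toSubgraph.Adj v w := hw
      rw [Finset.mem_coe, mem_nbrs, List.mem_toFinset]
      exact ⟨by simpa using c.toSubgraph.edge_vert hw'.symm, hw'.adj_sub⟩
    have h4 := Set.ncard_le_ncard h3 (Finset.finite_toSet _)
    rw [h2, Set.ncard_coe_finset] at h4
    omega
  | succ k ih =>
    by_cases hck : ∀ x ∈ c.support, x ∈ Γ.U k
    · exact ih hck
    · push Not at hck
      obtain ⟨w, hw, hwk⟩ := hck
      obtain ⟨s, i, h1, h2, rfl⟩ := (Γ.mem_succ.1 (hk w hw)).resolve_left hwk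
      -- Rotate the cycle to start at a new point. Its first edge then belongs to an arc, and the
      -- rest of the cycle is a detour around that edge.
      have hd := (SimpleGraph.Walk.isCycle_rotate hw).2 hc
      have hdl : (c.rotate _ hw).length = c.length := by simp
      have hds : ∀ x ∈ (c.rotate _ hw).support, x ∈ Γ.U (k + 1) := fun x hx =>
        hk x ((c.mem_support_rotate_iff _ hw).1 hx)
      rw [← hdl]
      generalize c.rotate _ hw = d at hd hds
      cases d with
      | nil => exact absurd hd SimpleGraph.Walk.not_isCycle_nil
      | cons hadj p =>
        rename_i y
        rw [SimpleGraph.Walk.cons_isCycle_iff] at hd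
        have hp : ∀ z ∈ p.support, z ∈ Γ.U (k + 1) := fun z hz => hds z (by simp [hz])
        rw [SimpleGraph.Walk.length_cons]
        rcases (Γ.adj_iff s h1 h2 (hp y p.start_mem_support)).1 hadj with rfl | rfl
        · obtain ⟨j, rfl⟩ : ∃ j, i = j + 1 := ⟨i - 1, by omega⟩
          have := Γ.two_mul_le_length hn s (i := j) (by omega) p hp
            (by have := hd.2; rwa [Sym2.eq_swap] at this)
          omega
        · have := Γ.two_mul_le_length hn s h2 p.reverse (by simpa using hp) (by simpa using hd.2)
          rw [SimpleGraph.Walk.length_reverse] at this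
          omega

/-! #### The values of `δₙ` on the stages -/

theorem exists_add_arcs (hn : 3 ≤ n) {A : Finset V} (hA : (A : Set V) = Γ.U k)
    (Q : Finset (Γ.Arc k)) : ∃ B : Finset V, delta n G B = delta n G A ∧
      B.card = A.card + (n - 2) * Q.card ∧ ∀ x, x ∈ B ↔ x ∈ A ∨
        ∃ s ∈ Q, x ∈ arcInterior n (Γ.arc s) := by
  classical
  induction Q using Finset.induction_on with
  | empty => exact ⟨A, rfl, by simp, by simp⟩
  | insert s Q hs ih =>
    obtain ⟨B, hd, hc, hB⟩ := ih
    have hAk : ∀ x, x ∈ A ↔ x ∈ Γ.U k := fun x => by rw [← hA, Finset.mem_coe]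
    have hsub : ((B ∪ arcInterior n (Γ.arc s) : Finset V) : Set V) ⊆ Γ.U (k + 1) := by
      intro x hx
      rw [Finset.mem_coe, Finset.mem_union, hB] at hx
      rcases hx with (hx | ⟨t, -, hx⟩) | hx
      · exact Γ.subset_succ k ((hAk x).1 hx)
      · obtain ⟨i, h1, h2, rfl⟩ := mem_arcInterior.1 hx
        exact Γ.arc_mem_succ hn t (by omega)
      · obtain ⟨i, h1, h2, rfl⟩ := mem_arcInterior.1 hx
        exact Γ.arc_mem_succ hn s (by omega)
    -- The added arc is clean in the enlarged set, so invariance of δₙ under arc removal is applied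
    -- backwards.
    have hclean : IsCleanArc n G (B ∪ arcInterior n (Γ.arc s)) (Γ.arc s) := by
      refine Γ.isCleanArc hn s hsub fun i hi => ?_
      rw [Finset.mem_union, hB]
      rcases Γ.arc_cases hn s hi with ⟨-, h⟩ | ⟨h, -⟩
      · exact Or.inl (Or.inl ((hAk _).2 h))
      · exact Or.inr (mem_arcInterior.2 ⟨i, h.1, h.2, rfl⟩)
    have hdisj : Disjoint B (arcInterior n (Γ.arc s)) := by
      rw [Finset.disjoint_right]
      intro x hx hxB
      obtain ⟨i, h1, h2, rfl⟩ := mem_arcInterior.1 hx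
      rcases (hB _).1 hxB with h | ⟨t, ht, h⟩
      · exact Γ.notMem s h1 h2 ((hAk _).1 h)
      · obtain ⟨j, h3, h4, h5⟩ := mem_arcInterior.1 h
        exact hs ((Γ.inj t s h3 h4 h1 h2 h5).1 ▸ ht)
    have hsd : (B ∪ arcInterior n (Γ.arc s)) \ arcInterior n (Γ.arc s) = B := by
      rw [Finset.union_sdiff_right, Finset.sdiff_eq_self_of_disjoint hdisj]
    refine ⟨B ∪ arcInterior n (Γ.arc s), ?_, ?_, fun x => ?_⟩
    · rw [hclean.delta_sdiff hn, hsd, hd]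
    · rw [hclean.card_sdiff, hsd, hc, Finset.card_insert_of_notMem hs]
      ring
    · rw [Finset.mem_union, hB]
      simp only [Finset.mem_insert, exists_eq_or_imp]
      exact or_assoc.trans (or_congr_right or_comm)

theorem exists_finset_eq_stage (hn : 3 ≤ n) [∀ k, Finite (Γ.Arc k)] {A : Finset V}
    (hA : (A : Set V) = Γ.U 0) (k : ℕ) :
    ∃ B : Finset V, (B : Set V) = Γ.U k ∧ delta n G B = delta n G A := by
  induction k with
  | zero => exact ⟨A, hA, rfl⟩
  | succ k ih =>
    obtain ⟨B, hB, hd⟩ := ih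
    have := Fintype.ofFinite (Γ.Arc k)
    obtain ⟨D, hD, -, hmem⟩ := Γ.exists_add_arcs hn hB Finset.univ
    refine ⟨D, ?_, hD.trans hd⟩
    ext x
    rw [Finset.mem_coe, hmem, ← Finset.mem_coe, hB, Γ.mem_succ]
    simp [mem_arcInterior]

theorem exists_delta_eq (hn : 3 ≤ n) [∀ k, Finite (Γ.Arc k)] {A : Finset V}
    (hA : (A : Set V) = Γ.U 0) (A₀ : Finset V) :
    ∃ B : Finset V, A₀ ⊆ B ∧ delta n G B = delta n G A := by
  obtain ⟨k, hk⟩ := Γ.exists_stage A₀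
  obtain ⟨B, hB, hd⟩ := Γ.exists_finset_eq_stage hn hA k
  exact ⟨B, fun x hx => by rw [← Finset.mem_coe, hB]; exact hk hx, hd⟩

end ArcTower

/-! ### The stages of a free completion -/

section Stages

variable {n : ℕ} {G₀ : SimpleGraph V} {k : ℕ} {a b x y : FreeVertex V}

theorem arcPath_zero (n : ℕ) (a b : FreeVertex V) : arcPath n a b 0 = a := rfl

theorem arcPath_last (hn : 3 ≤ n) (a b : FreeVertex V) : arcPath n a b (n - 1) = b := by
  rw [arcPath, if_neg (by omega), if_neg (by omega)]

theorem arcPath_interior {i : ℕ} (h1 : 1 ≤ i) (h2 : i + 1 < n) (a b : FreeVertex V) :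
    arcPath n a b i = .arc a b i := by
  rw [arcPath, if_neg (by omega), if_pos h2]

theorem FreeVertex.arc_ne_left (a b : FreeVertex V) (i : ℕ) : FreeVertex.arc a b i ≠ a := by
  intro h
  have := congrArg sizeOf h
  simp only [FreeVertex.arc.sizeOf_spec] at this
  omega

theorem FreeVertex.arc_ne_right (a b : FreeVertex V) (i : ℕ) : FreeVertex.arc a b i ≠ b := by
  intro h
  have := congrArg sizeOf h
  simp only [FreeVertex.arc.sizeOf_spec] at this
  omega

theorem arcPath_ne_succ (hn : 3 ≤ n) (a b : FreeVertex V) {i : ℕ} (hi : i + 1 < n) :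
    arcPath n a b i ≠ arcPath n a b (i + 1) := by
  rcases Nat.eq_zero_or_pos i with rfl | h0
  · rw [arcPath_zero, arcPath_interior le_rfl (by omega)]
    exact (FreeVertex.arc_ne_left a b _).symm
  · rw [arcPath_interior h0 hi]
    by_cases h : i + 1 = n - 1
    · rw [h, arcPath_last hn]
      exact FreeVertex.arc_ne_right a b _
    · rw [arcPath_interior (by omega) (by omega)]
      simp

theorem NeedsArc.reachable {W : Type u} {G : SimpleGraph W} {a b : W} (h : NeedsArc n G a b) :
    G.Reachable a b :=
  SimpleGraph.Reachable.of_dist_ne_zero (by rw [h.2]; omega)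

theorem NeedsArc.ne {W : Type u} {G : SimpleGraph W} {a b : W} (h : NeedsArc n G a b) : a ≠ b := by
  rintro rfl
  have := h.2
  rw [SimpleGraph.dist_self] at this
  omega

theorem NeedsArc.not_swap {W : Type u} {G G' : SimpleGraph W} {a b : W} (h : NeedsArc n G a b) :
    ¬ NeedsArc n G' b a := fun h' => asymm_of WellOrderingRel h.1 h'.1

theorem needsArc_or_swap {W : Type u} {G : SimpleGraph W} {a b : W} (h : G.dist a b = n + 1) :
    NeedsArc n G a b ∨ NeedsArc n G b a := by
  have hne : a ≠ b := by
    rintro rfl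
    rw [SimpleGraph.dist_self] at h
    omega
  rcases trichotomous_of WellOrderingRel a b with h' | h' | h'
  · exact Or.inl ⟨h', h⟩
  · exact absurd h' hne
  · exact Or.inr ⟨h', by rw [SimpleGraph.dist_comm, h]⟩

theorem exists_adj_of_reachable {W : Type u} {G : SimpleGraph W} {a b : W} (h : G.Reachable a b)
    (hne : a ≠ b) : ∃ c, G.Adj a c := by
  obtain ⟨p⟩ := h
  cases p with
  | nil => exact absurd rfl hne
  | cons h _ => exact ⟨_, h⟩

theorem stageGraph_succ_adj : (stageGraph n G₀ (k + 1)).Adj x y ↔ (stageGraph n G₀ k).Adj x y ∨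
    x ≠ y ∧ ∃ a b, NeedsArc n (stageGraph n G₀ k) a b ∧ ∃ i, i + 1 < n ∧
      (x = arcPath n a b i ∧ y = arcPath n a b (i + 1) ∨
        y = arcPath n a b i ∧ x = arcPath n a b (i + 1)) := by
  rw [stageGraph, addArcs, SimpleGraph.sup_adj, SimpleGraph.fromRel_adj]
  refine or_congr_right (and_congr_right fun _ => ?_)
  constructor
  · rintro (⟨a, b, h, i, hi, h'⟩ | ⟨a, b, h, i, hi, h'⟩)
    exacts [⟨a, b, h, i, hi, Or.inl h'⟩, ⟨a, b, h, i, hi, Or.inr h'⟩]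
  · rintro ⟨a, b, h, i, hi, h' | h'⟩
    exacts [Or.inl ⟨a, b, h, i, hi, h'⟩, Or.inr ⟨a, b, h, i, hi, h'⟩]

theorem stageVerts_mono : Monotone (stageVerts n G₀) :=
  monotone_nat_of_le_succ fun _ _ hx => Or.inl hx

theorem stageGraph_mono : Monotone (stageGraph n G₀) :=
  monotone_nat_of_le_succ fun _ => le_sup_left

theorem arcPath_mem (ha : a ∈ stageVerts n G₀ k) (hb : b ∈ stageVerts n G₀ k)
    (h : NeedsArc n (stageGraph n G₀ k) a b) (i : ℕ) :
    arcPath n a b i ∈ stageVerts n G₀ (k + 1) := by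
  unfold arcPath
  split_ifs with h0 h1
  · exact Or.inl ha
  · exact Or.inr ⟨a, b, h, i, by omega, h1, rfl⟩
  · exact Or.inl hb

theorem mem_stageVerts_of_adj (h : (stageGraph n G₀ k).Adj x y) : x ∈ stageVerts n G₀ k := by
  induction k generalizing x y with
  | zero =>
    rw [stageGraph, SimpleGraph.map_adj'] at h
    obtain ⟨-, v, w, -, rfl, -⟩ := h
    exact ⟨v, rfl⟩
  | succ k ih =>
    rcases stageGraph_succ_adj.1 h with h | ⟨-, a, b, hab, i, hi, h⟩
    · exact Or.inl (ih h)
    · obtain ⟨c, hc⟩ := exists_adj_of_reachable hab.reachable hab.ne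
      obtain ⟨d, hd⟩ := exists_adj_of_reachable hab.reachable.symm hab.ne.symm
      rcases h with ⟨rfl, -⟩ | ⟨-, rfl⟩
      all_goals exact arcPath_mem (ih hc) (ih hd) hab _

theorem NeedsArc.left_mem (h : NeedsArc n (stageGraph n G₀ k) a b) : a ∈ stageVerts n G₀ k :=
  mem_stageVerts_of_adj (exists_adj_of_reachable h.reachable h.ne).choose_spec

theorem NeedsArc.right_mem (h : NeedsArc n (stageGraph n G₀ k) a b) : b ∈ stageVerts n G₀ k :=
  mem_stageVerts_of_adj (exists_adj_of_reachable h.reachable.symm h.ne.symm).choose_spec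

theorem exists_needsArc_of_arc_mem {i : ℕ} (h : FreeVertex.arc a b i ∈ stageVerts n G₀ k) :
    ∃ j < k, NeedsArc n (stageGraph n G₀ j) a b := by
  induction k with
  | zero =>
    obtain ⟨v, hv⟩ := h
    cases hv
  | succ k ih =>
    rcases h with h | ⟨a', b', h, i', -, -, he⟩
    · obtain ⟨j, hj, h⟩ := ih h
      exact ⟨j, by omega, h⟩
    · cases he
      exact ⟨k, by omega, h⟩

/-- Each pair receives an arc at most once: afterwards its distance is at most n-1 in all later
stages, never n+1 again. So the names of a new arc are fresh. -/
theorem NeedsArc.arc_notMem (hn : 3 ≤ n) (h : NeedsArc n (stageGraph n G₀ k) a b) (i : ℕ) :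
    FreeVertex.arc a b i ∉ stageVerts n G₀ k := by
  intro hmem
  obtain ⟨j, hj, h'⟩ := exists_needsArc_of_arc_mem hmem
  obtain ⟨p, hp, -⟩ := exists_walk_of_seq (G := stageGraph n G₀ (j + 1)) (arcPath n a b) (n - 1)
    fun i hi => stageGraph_succ_adj.2 (Or.inr ⟨arcPath_ne_succ hn a b (by omega), a, b, h', i,
      by omega, Or.inl ⟨rfl, rfl⟩⟩)
  have h1 := SimpleGraph.dist_le (p.mapLe (stageGraph_mono (Nat.succ_le_of_lt hj)))
  rw [SimpleGraph.Walk.length_mapLe, hp, arcPath_zero, arcPath_last hn, h.2] at h1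
  omega

/-- Stages are induced subgraphs of later ones: since n ≥ 3, every edge of a new arc has an
interior, hence new, endpoint. -/
theorem stageGraph_adj_of_succ (hn : 3 ≤ n) (hx : x ∈ stageVerts n G₀ k)
    (hy : y ∈ stageVerts n G₀ k) (h : (stageGraph n G₀ (k + 1)).Adj x y) :
    (stageGraph n G₀ k).Adj x y := by
  rcases stageGraph_succ_adj.1 h with h | ⟨-, a, b, hab, i, hi, h⟩
  · exact h
  · exfalso
    have key : arcPath n a b i ∈ stageVerts n G₀ k →
        arcPath n a b (i + 1) ∈ stageVerts n G₀ k → False := by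
      intro h1 h2
      rcases Nat.eq_zero_or_pos i with rfl | h0
      · rw [arcPath_interior le_rfl (by omega)] at h2
        exact hab.arc_notMem hn _ h2
      · rw [arcPath_interior h0 hi] at h1
        exact hab.arc_notMem hn _ h1
    rcases h with ⟨rfl, rfl⟩ | ⟨rfl, rfl⟩
    exacts [key hx hy, key hy hx]

theorem iSup_stageGraph_adj (hn : 3 ≤ n) (hx : x ∈ stageVerts n G₀ k)
    (hy : y ∈ stageVerts n G₀ k) :
    (⨆ k, stageGraph n G₀ k).Adj x y ↔ (stageGraph n G₀ k).Adj x y := by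
  rw [SimpleGraph.iSup_adj]
  refine ⟨?_, fun h => ⟨k, h⟩⟩
  rintro ⟨m, hm⟩
  rcases le_total m k with h | h
  · exact stageGraph_mono h hm
  · induction m, h using Nat.le_induction with
    | base => exact hm
    | succ m h ih =>
      exact ih (stageGraph_adj_of_succ hn (stageVerts_mono h hx) (stageVerts_mono h hy) hm)

theorem stageGraph_succ_adj_arc (hn : 3 ≤ n) (hab : NeedsArc n (stageGraph n G₀ k) a b) {i : ℕ}
    (h1 : 1 ≤ i) (h2 : i + 1 < n) : (stageGraph n G₀ (k + 1)).Adj (.arc a b i) y ↔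
      y = arcPath n a b (i - 1) ∨ y = arcPath n a b (i + 1) := by
  rw [stageGraph_succ_adj]
  constructor
  · rintro (h | ⟨-, a', b', hab', i', hi', h⟩)
    · exact absurd (mem_stageVerts_of_adj h) (hab.arc_notMem hn i)
    · have key : ∀ j, FreeVertex.arc a b i = arcPath n a' b' j → a' = a ∧ b' = b ∧ j = i := by
        intro j hj
        unfold arcPath at hj
        split_ifs at hj
        · exact absurd (hj ▸ hab'.left_mem) (hab.arc_notMem hn i)
        · cases hj; exact ⟨rfl, rfl, rfl⟩
        · exact absurd (hj ▸ hab'.right_mem) (hab.arc_notMem hn i)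
      rcases h with ⟨h, rfl⟩ | ⟨rfl, h⟩
      · obtain ⟨rfl, rfl, rfl⟩ := key _ h
        exact Or.inr rfl
      · obtain ⟨rfl, rfl, rfl⟩ := key _ h
        exact Or.inl rfl
  · rintro (rfl | rfl)
    · obtain ⟨j, rfl⟩ : ∃ j, i = j + 1 := ⟨i - 1, by omega⟩
      rw [← arcPath_interior (n := n) h1 h2]
      exact Or.inr ⟨(arcPath_ne_succ hn a b (by omega)).symm, a, b, hab, j, by omega,
        Or.inr ⟨rfl, rfl⟩⟩
    · rw [← arcPath_interior (n := n) h1 h2]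
      exact Or.inr ⟨arcPath_ne_succ hn a b h2, a, b, hab, i, h2, Or.inl ⟨rfl, rfl⟩⟩

theorem finite_stageVerts [Finite V] (k : ℕ) : (stageVerts n G₀ k).Finite := by
  induction k with
  | zero => exact Set.finite_range _
  | succ k ih =>
    refine ih.union (((ih.prod ih).prod (Set.finite_lt_nat n)).image
      (fun p => FreeVertex.arc p.1.1 p.1.2 p.2) |>.subset ?_)
    rintro x ⟨a, b, hab, i, -, hi, rfl⟩
    exact ⟨((a, b), i), ⟨⟨hab.left_mem, hab.right_mem⟩, by simp only [Set.mem_ofPred_eq]; omega⟩, rfl⟩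

end Stages

/-! ### The free completion as a graph built by adding arcs -/

section Completion

variable {n : ℕ} {G₀ : SimpleGraph V}

theorem freeCompletion_adj (hn : 3 ≤ n) {k : ℕ}
    {x y : {x : FreeVertex V // ∃ k, x ∈ stageVerts n G₀ k}}
    (hx : x.1 ∈ stageVerts n G₀ k) (hy : y.1 ∈ stageVerts n G₀ k) :
    (freeCompletion n G₀).Adj x y ↔ (stageGraph n G₀ k).Adj x.1 y.1 :=
  iSup_stageGraph_adj hn hx hy

/-- The embedding of `G₀` into its free completion. -/
def baseEmbedding (hn : 3 ≤ n) (G₀ : SimpleGraph V) : G₀ ↪g freeCompletion n G₀ where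
  toFun v := ⟨.base v, 0, v, rfl⟩
  inj' v w h := by
    have := congrArg Subtype.val h
    exact FreeVertex.base.inj this
  map_rel_iff' {v w} := by
    rw [freeCompletion_adj (k := 0) hn ⟨v, rfl⟩ ⟨w, rfl⟩]
    exact SimpleGraph.map_adj_apply (f := ⟨FreeVertex.base, fun _ _ => FreeVertex.base.inj⟩)

theorem nbrs_map {W : Type*} {G : SimpleGraph V} {H : SimpleGraph W} (f : G ↪g H) (A : Finset V)
    (v : V) : nbrs H (A.map f.toEmbedding) (f v) = (nbrs G A v).map f.toEmbedding := by
  ext w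
  simp only [mem_nbrs, Finset.mem_map]
  constructor
  · rintro ⟨⟨x, hx, rfl⟩, h⟩
    exact ⟨x, ⟨hx, f.map_adj_iff.1 h⟩, rfl⟩
  · rintro ⟨x, ⟨hx, h⟩, rfl⟩
    exact ⟨⟨x, hx, rfl⟩, f.map_adj_iff.2 h⟩

theorem delta_map (n : ℕ) {W : Type*} {G : SimpleGraph V} {H : SimpleGraph W} (f : G ↪g H)
    (A : Finset V) : delta n H (A.map f.toEmbedding) = delta n G A := by
  have h1 := two_mul_numEdges H (A.map f.toEmbedding)
  have h2 : ∑ v ∈ A, (nbrs H (A.map f.toEmbedding) (f v)).card = ∑ v ∈ A, (nbrs G A v).card :=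
    Finset.sum_congr rfl fun v _ => by rw [nbrs_map, Finset.card_map]
  rw [Finset.sum_map] at h1
  have h3 := h1.trans (h2.trans (two_mul_numEdges G A).symm)
  rw [delta_eq, delta_eq, Finset.card_map, show numEdges H (A.map f.toEmbedding) = numEdges G A by omega]

theorem exists_stage_walk (hn : 3 ≤ n) {k : ℕ}
    {x y : {x : FreeVertex V // ∃ k, x ∈ stageVerts n G₀ k}} (p : (freeCompletion n G₀).Walk x y)
    (hp : ∀ z ∈ p.support, z.1 ∈ stageVerts n G₀ k) :
    ∃ q : (stageGraph n G₀ k).Walk x.1 y.1, q.length = p.length := by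
  induction p with
  | nil => exact ⟨.nil, rfl⟩
  | cons h p ih =>
    obtain ⟨q, hq⟩ := ih fun z hz => hp z (by simp [hz])
    exact ⟨.cons ((freeCompletion_adj hn (hp _ (by simp)) (hp _ (by simp))).1 h) q, by simp [hq]⟩

/-- The free completion of a graph all of whose finite subgraphs have loose ends. -/
def freeTower (hn : 3 ≤ n)
    (hbase : ∀ B : Finset V, B.Nonempty → ∃ v ∈ B, (nbrs G₀ B v).card ≤ 1) :
    ArcTower.{u, u} n (freeCompletion n G₀) where
  U k := {x | x.1 ∈ stageVerts n G₀ k}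
  Arc k := {p : FreeVertex V × FreeVertex V // NeedsArc n (stageGraph n G₀ k) p.1 p.2}
  arc {k} s i := ⟨arcPath n s.1.1 s.1.2 i, k + 1, arcPath_mem s.2.left_mem s.2.right_mem s.2 i⟩
  cover x := x.2
  mem_succ {k x} := by
    refine or_congr Iff.rfl ⟨?_, ?_⟩
    · rintro ⟨a, b, h, i, h1, h2, h3⟩
      exact ⟨⟨(a, b), h⟩, i, h1, h2, Subtype.ext (by rw [h3]; exact arcPath_interior h1 h2 a b)⟩
    · rintro ⟨s, i, h1, h2, rfl⟩
      exact ⟨_, _, s.2, i, h1, h2, arcPath_interior h1 h2 _ _⟩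
  first_mem s := s.2.left_mem
  last_mem s := by
    simp only [Set.mem_ofPred_eq, arcPath_last hn]
    exact s.2.right_mem
  notMem {k} s {i} h1 h2 := by
    simp only [Set.mem_ofPred_eq, arcPath_interior h1 h2]
    exact s.2.arc_notMem hn i
  inj {k} s t {i j} h1 h2 h3 h4 h := by
    have h' := congrArg Subtype.val h
    simp only [arcPath_interior h1 h2, arcPath_interior h3 h4, FreeVertex.arc.injEq] at h'
    exact ⟨Subtype.ext (Prod.ext h'.1 h'.2.1), h'.2.2⟩
  adj_iff {k} s {i y} h1 h2 hy := by
    rw [freeCompletion_adj hn (arcPath_mem s.2.left_mem s.2.right_mem s.2 i) hy, Subtype.ext_iff,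
      Subtype.ext_iff]
    simp only [arcPath_interior h1 h2]
    exact stageGraph_succ_adj_arc hn s.2 h1 h2
  far s := by
    rintro ⟨p, hp, hs⟩
    obtain ⟨q, hq⟩ := exists_stage_walk hn p hs
    have h := (SimpleGraph.dist_le q).trans (hq.le.trans hp)
    simp only [arcPath_zero, arcPath_last hn, s.2.2] at h
    omega
  ends_ne s t hst h h' := by
    have h1 := congrArg Subtype.val h
    have h2 := congrArg Subtype.val h'
    simp only [arcPath_zero, arcPath_last hn] at h1 h2
    exact hst (Subtype.ext (Prod.ext h1 h2))
  -- The well-order selects one orientation per pair, so no arc joins the same two ends in reverse.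
  ends_ne' s t h h' := by
    have h1 := congrArg Subtype.val h
    have h2 := congrArg Subtype.val h'
    simp only [arcPath_zero, arcPath_last hn] at h1 h2
    exact s.2.not_swap (h1 ▸ h2 ▸ t.2)
  base A hA hAU := by
    classical
    let f := baseEmbedding hn G₀
    obtain ⟨B, rfl⟩ : ∃ B : Finset V, A = B.map f.toEmbedding := by
      refine ⟨A.preimage f f.injective.injOn, ?_⟩
      ext x
      rw [Finset.mem_map]
      constructor
      · intro hx
        obtain ⟨v, hv⟩ := hAU hx
        have : f v = x := Subtype.ext hv
        exact ⟨v, Finset.mem_preimage.2 (this ▸ hx), this⟩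
      · rintro ⟨v, hv, rfl⟩
        exact Finset.mem_preimage.1 hv
    obtain ⟨v, hv, hv1⟩ := hbase B (by simpa using hA)
    refine ⟨f v, Finset.mem_map_of_mem _ hv, ?_⟩
    rwa [nbrs_map, Finset.card_map]

/-- Minimality of free completions with at least two arcs in the first step. -/
theorem isMinimal_freeCompletion [Fintype V] (hn : 3 ≤ n) (C : (freeCompletion n G₀).Coloring Bool)
    (hbase : ∀ B : Finset V, B.Nonempty → ∃ v ∈ B, (nbrs G₀ B v).card ≤ 1)
    (hdelta : delta n G₀ Finset.univ = 2 * (n : ℤ) + 2) (hcard : n + 4 ≤ Fintype.card V)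
    (hArc : ∃ s t : FreeVertex V × FreeVertex V, s ≠ t ∧
      NeedsArc n (stageGraph n G₀ 0) s.1 s.2 ∧ NeedsArc n (stageGraph n G₀ 0) t.1 t.2) :
    IsMinimal C := by
  classical
  let Γ := freeTower hn hbase
  have hfin : ∀ k, Finite (Γ.Arc k) := fun k => by
    have hS := finite_stageVerts (n := n) (G₀ := G₀) k
    have hP : {p : FreeVertex V × FreeVertex V |
        NeedsArc n (stageGraph n G₀ k) p.1 p.2}.Finite :=
      (hS.prod hS).subset fun p (hp : NeedsArc n (stageGraph n G₀ k) p.1 p.2) =>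
        ⟨hp.left_mem, hp.right_mem⟩
    exact hP.to_subtype
  let A := Finset.univ.map (baseEmbedding hn G₀).toEmbedding
  have hA : (A : Set _) = Γ.U 0 := by
    ext x
    simp only [A, Finset.coe_map, Finset.coe_univ, Set.image_univ]
    constructor
    · rintro ⟨v, rfl⟩
      exact ⟨v, rfl⟩
    · rintro ⟨v, hv⟩
      exact ⟨v, Subtype.ext hv⟩
  have hdA : delta n (freeCompletion n G₀) A = 2 * (n : ℤ) + 2 := (delta_map n _ _).trans hdelta
  refine isMinimal_of_cofinal hn C (Γ.hasLooseEndsOrArcs hn) (Γ.le_egirth hn C) (fun A₀ => ?_) ?_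
  · obtain ⟨B, hB, hd⟩ := Γ.exists_delta_eq hn hA A₀
    exact ⟨B, hB, hd.trans hdA⟩
  · obtain ⟨s, t, hst, hs, ht⟩ := hArc
    let s' : Γ.Arc 0 := ⟨s, hs⟩
    let t' : Γ.Arc 0 := ⟨t, ht⟩
    have hne : s' ≠ t' := fun h => hst (congrArg Subtype.val h)
    -- Two arcs suffice: (n+4) + 2(n-2) = 3n.
    obtain ⟨B, -, hB, -⟩ := Γ.exists_add_arcs hn hA {s', t'}
    refine ⟨B, ?_⟩
    have hAc : A.card = Fintype.card V := by simp [A, Finset.card_univ]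
    rw [hB, Finset.card_pair hne, hAc]
    omega

end Completion

/-! ### Paths -/

/-- The vertex of least index in B can only be adjacent to its successor. -/
theorem pathGraph_exists_nbrs_card_le {m : ℕ} (B : Finset (Fin m)) (hB : B.Nonempty) :
    ∃ v ∈ B, (nbrs (SimpleGraph.pathGraph m) B v).card ≤ 1 := by
  refine ⟨B.min' hB, B.min'_mem hB, Finset.card_le_one.2 fun x hx y hy => ?_⟩
  rw [mem_nbrs, SimpleGraph.pathGraph_adj] at hx hy
  have h1 := Fin.le_def.1 (B.min'_le x hx.1)
  have h2 := Fin.le_def.1 (B.min'_le y hy.1)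
  apply Fin.ext
  omega

theorem numEdges_pathGraph (m : ℕ) : numEdges (SimpleGraph.pathGraph (m + 1)) Finset.univ = m := by
  classical
  have key : ∀ l, l ≤ m →
      numEdges (SimpleGraph.pathGraph (m + 1)) (Finset.univ.filter fun i => i.val ≤ l) = l := by
    intro l
    induction l with
    | zero =>
      intro _
      have h := two_mul_numEdges (SimpleGraph.pathGraph (m + 1))
        (Finset.univ.filter fun i => i.val ≤ 0)
      rw [Finset.sum_eq_zero] at h
      · omega
      · intro v hv
        rw [Finset.card_eq_zero, Finset.eq_empty_iff_forall_notMem]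
        intro w hw
        rw [mem_nbrs, SimpleGraph.pathGraph_adj] at hw
        simp only [Finset.mem_filter] at hv hw
        omega
    | succ l ih =>
      intro hl
      have hv : (⟨l + 1, by omega⟩ : Fin (m + 1)) ∈
          Finset.univ.filter fun i : Fin (m + 1) => i.val ≤ l + 1 := by simp
      have h1 : (Finset.univ.filter fun i : Fin (m + 1) => i.val ≤ l + 1).erase
          ⟨l + 1, by omega⟩ = Finset.univ.filter fun i => i.val ≤ l := by
        ext i
        simp only [Finset.mem_erase, Finset.mem_filter, Finset.mem_univ, true_and, ne_eq,
          Fin.ext_iff]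
        omega
      have h2 : nbrs (SimpleGraph.pathGraph (m + 1))
          (Finset.univ.filter fun i => i.val ≤ l + 1) ⟨l + 1, by omega⟩ = {⟨l, by omega⟩} := by
        ext i
        simp only [mem_nbrs, SimpleGraph.pathGraph_adj, Finset.mem_filter, Finset.mem_univ,
          true_and, Finset.mem_singleton, Fin.ext_iff]
        omega
      rw [numEdges_erase _ hv, h1, h2, ih (by omega), Finset.card_singleton]
  have h := key m le_rfl
  rwa [Finset.filter_true_of_mem fun i _ => by omega] at h

theorem dist_stageGraph_pathGraph {n m i j : ℕ} (hij : i ≤ j) (hj : j < m + 1) :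
    (stageGraph n (SimpleGraph.pathGraph (m + 1)) 0).dist (.base ⟨i, by omega⟩) (.base ⟨j, hj⟩) =
      j - i := by
  let f : Fin (m + 1) ↪ FreeVertex (Fin (m + 1)) := ⟨.base, fun _ _ => FreeVertex.base.inj⟩
  have hadj : ∀ v w, (stageGraph n (SimpleGraph.pathGraph (m + 1)) 0).Adj (.base v) (.base w) ↔
      (SimpleGraph.pathGraph (m + 1)).Adj v w := fun v w => SimpleGraph.map_adj_apply (f := f)
  obtain ⟨p, hp, -⟩ := exists_walk_of_seq
    (G := stageGraph n (SimpleGraph.pathGraph (m + 1)) 0)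
    (fun l => .base (Fin.ofNat (m + 1) (i + l))) (j - i) fun l hl => by
      rw [hadj, SimpleGraph.pathGraph_adj]
      simp only [Fin.val_ofNat]
      rw [Nat.mod_eq_of_lt (by omega), Nat.mod_eq_of_lt (by omega)]
      omega
  have e1 : Fin.ofNat (m + 1) (i + 0) = ⟨i, by omega⟩ :=
    Fin.ext (by simp only [Fin.val_ofNat]; rw [Nat.mod_eq_of_lt (by omega)]; omega)
  have e2 : Fin.ofNat (m + 1) (i + (j - i)) = ⟨j, hj⟩ :=
    Fin.ext (by simp only [Fin.val_ofNat]; rw [Nat.mod_eq_of_lt (by omega)]; omega)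
  refine le_antisymm ?_ ?_
  · have := SimpleGraph.dist_le p
    rwa [hp, e1, e2] at this
  · have hr := p.reachable
    rw [e1, e2] at hr
    obtain ⟨q, hq⟩ := hr.exists_walk_length_eq_dist
    rw [← hq]
    -- Each edge raises the index by at most one, which gives the lower bound on the distance.
    have key : ∀ {x y} (q : (stageGraph n (SimpleGraph.pathGraph (m + 1)) 0).Walk x y) v w,
        x = .base v → y = .base w → w.val ≤ v.val + q.length := by
      intro x y q
      induction q with
      | nil =>
        rintro v w rfl h
        cases h
        exact Nat.le_add_right _ _
      | cons h q ih =>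
        rintro v w rfl rfl
        obtain ⟨z, rfl⟩ := mem_stageVerts_of_adj h.symm
        have h1 := ih z w rfl rfl
        rw [hadj, SimpleGraph.pathGraph_adj] at h
        rw [SimpleGraph.Walk.length_cons]
        omega
    have := key q _ _ rfl rfl
    simp only at this
    omega

theorem isMinimal_freePolygon {n : ℕ} (hn : 3 ≤ n)
    (C : (freePolygon n (n + 3)).Coloring Bool) : IsMinimal C := by
  refine isMinimal_freeCompletion hn C (fun B hB => pathGraph_exists_nbrs_card_le B hB) ?_
    (by simp) ?_
  -- The path has n+4 vertices and n+3 edges, and (n-1)(n+4) - (n-2)(n+3) = 2n+2.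
  · rw [delta_eq, numEdges_pathGraph, Finset.card_univ, Fintype.card_fin]
    push_cast
    ring
  -- The two arcs join x₀ to xₙ₊₁ and x₁ to xₙ₊₂, each in the order that the well-order dictates.
  · have h1 := dist_stageGraph_pathGraph (n := n) (m := n + 3) (Nat.zero_le (n + 1)) (by omega)
    have h2 := dist_stageGraph_pathGraph (n := n) (m := n + 3) (show 1 ≤ n + 2 by omega) (by omega)
    have hne : ∀ i j (hi : i < n + 3 + 1) (hj : j < n + 3 + 1), i ≠ j →
        FreeVertex.base (⟨i, hi⟩ : Fin (n + 3 + 1)) ≠ .base ⟨j, hj⟩ := by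
      intro i j hi hj hij h
      exact hij (Fin.mk.inj (FreeVertex.base.inj h))
    rcases needsArc_or_swap (n := n) (h1.trans (by omega)) with h1 | h1 <;>
      rcases needsArc_or_swap (n := n) (h2.trans (by omega)) with h2 | h2
    · exact ⟨(_, _), (_, _), fun h => hne _ _ _ _ (by omega) (congrArg Prod.fst h), h1, h2⟩
    · exact ⟨(_, _), (_, _), fun h => hne _ _ _ _ (by omega) (congrArg Prod.fst h), h1, h2⟩
    · exact ⟨(_, _), (_, _), fun h => hne _ _ _ _ (by omega) (congrArg Prod.snd h), h1, h2⟩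
    · exact ⟨(_, _), (_, _), fun h => hne _ _ _ _ (by omega) (congrArg Prod.fst h), h1, h2⟩

end GenPolygon

theorem mainTheorem10 (n : ℕ) (hn : 3 ≤ n) :
    (∀ {V : Type*} (G : SimpleGraph V) (C : G.Coloring Bool),
      GenPolygon.IsGeneralizedPolygon n G → GenPolygon.IsOpenGraph n G →
      (∀ A₀ : Finset V, ∃ A : Finset V, A₀ ⊆ A ∧
        GenPolygon.delta n G A = 2 * (n : ℤ) + 2) →
      GenPolygon.IsMinimal C) ∧
    (∀ C₀ : (SimpleGraph.pathGraph (n + 3 + 1)).Coloring Bool,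
      GenPolygon.IsMinimal (G := GenPolygon.freePolygon n (n + 3))
        (GenPolygon.freeColoring n C₀)) :=
  ⟨fun _ C hG ho hcof => GenPolygon.isMinimal_of_isGeneralizedPolygon hn C hG ho hcof,
    fun _ => GenPolygon.isMinimal_freePolygon hn _⟩
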